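/- Let $-\infty\le\alpha<\beta\le\infty$ and $U=\{s\in\mathbb{C}:\alpha<\operatorname{Re}s<\beta\}$. A function $f$ analytic in $U$ is called almost periodic in $U$ if for every reduced strip $\{a\le\operatorname{Re}s\le b\}$ with $\alpha<a\le b<\beta$ and every $\varepsilon>0$ there is $l>0$ such that every interval $(t_0,t_0+l)$ contains a $\tau$ with $|f(s+i\tau)-f(s)|\le\varepsilon$ for all $s$ in the reduced strip. Its Dirichlet series is $\sum_{i\ge1}a_ie^{\lambda_is}$, where $\lambda_1,\lambda_2,\ldots$ are the (finitely or countably many, distinct) Fourier exponents of $f$, that is, the real numbers $\lambda$ for which the mean value $$a(\lambda)=\lim_{T\to\infty}\frac1{2T}\int_{-T}^{T}f(\sigma+it)\,e^{-\lambda(\sigma+it)}\,dt$$ (which does not depend on $\sigma\in(\alpha,\beta)$) is nonzero, and $a_i=a(\lambda_i)$. Let $f$ be almost periodic in $U$ and let $U$ be its largest open vertical strip of almost periodicity, i.e. $f$ has no almost periodic extension to a strictly larger open vertical strip. Suppose that $f$ has at least three Fourier exponents, that its Fourier exponents are linearly independent over $\mathbb{Q}$, and that at least one of the following conditions holds (in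 $[0,\infty]$, the value $\infty$ being allowed for the limits, and with $e^{-\infty}=0$, $e^{\infty}=\infty$): a) $\displaystyle\lim_{\sigma\to\alpha^+}\sum_{i\ge1}|a_i|e^{\sigma\lambda_i}>2\sup\{|a_i|e^{\alpha\lambda_i}:i\ge1\}$; b) $\displaystyle\lim_{\sigma\to\beta^-}\sum_{i\ge1}|a_i|e^{\sigma\lambda_i}>2\sup\{|a_i|e^{\beta\lambda_i}:i\ge1\}$. Then the set $R_f:=\overline{\{\operatorname{Re}s:f(s)=0,\ s\in U\}}\cap(\alpha,\beta)$ is nonempty. -/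

import Mathlib

open Set Filter Topology

noncomputable section

namespace APStrip

/-- The open vertical strip `{s : α < Re s < β}`, where `-∞ ≤ α` and `β ≤ ∞`. -/
def strip (α β : EReal) : Set ℂ :=
  {s | α < (s.re : EReal) ∧ (s.re : EReal) < β}

/-- `f` is (analytic) almost periodic in the open strip `α < Re s < β`: it is analytic there and,
on each reduced strip `a ≤ Re s ≤ b` with `α < a ≤ b < β`, for every `ε > 0` there is a length `l`
such that each interval `(t₀, t₀ + l)` contains a translation number `τ` of `f` belonging to `ε`,
uniformly on the reduced strip. The values of `f` outside the strip play no role. -/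
def IsAlmostPeriodic (α β : EReal) (f : ℂ → ℂ) : Prop :=
  AnalyticOnNhd ℂ f (strip α β) ∧
    ∀ a b : ℝ, α < (a : EReal) → a ≤ b → (b : EReal) < β →
      ∀ ε : ℝ, 0 < ε → ∃ l : ℝ, 0 < l ∧ ∀ t₀ : ℝ, ∃ τ ∈ Ioo t₀ (t₀ + l),
        ∀ s : ℂ, s.re ∈ Icc a b → ‖f (s + τ * Complex.I) - f s‖ ≤ ε

/-- The strip `(α, β)` is the largest open vertical strip of almost periodicity of `f`:
`f` is almost periodic in it and has no almost periodic extension to a larger open strip. -/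
def IsLargestStrip (α β : EReal) (f : ℂ → ℂ) : Prop :=
  IsAlmostPeriodic α β f ∧
    ∀ (α' β' : EReal) (g : ℂ → ℂ), α' ≤ α → β ≤ β' → IsAlmostPeriodic α' β' g →
      EqOn g f (strip α β) → α' = α ∧ β' = β

/-- `c` is the coefficient of `f` at the frequency `x`: for every `σ` in `(α, β)`, it is the mean
value in `t` of `f (σ + i t) e ^ (- x (σ + i t))`. -/
def HasDirichletCoeff (α β : EReal) (f : ℂ → ℂ) (x : ℝ) (c : ℂ) : Prop :=
  ∀ σ : ℝ, α < (σ : EReal) → (σ : EReal) < β →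
    Tendsto (fun T : ℝ => ((2 * T)⁻¹ : ℝ) •
        ∫ t in (-T)..T, f (σ + t * Complex.I) * Complex.exp (-(x * (σ + t * Complex.I))))
      atTop (𝓝 c)

/-- `∑ a i e ^ (lam i s)` is the Dirichlet series of `f` in the strip `(α, β)`: the numbers `lam i`
are the Fourier exponents of `f` (the frequencies with nonzero coefficient), listed without
repetition, and the `a i` are the corresponding coefficients. -/
structure IsDirichletSeries {ι : Type*} (α β : EReal) (f : ℂ → ℂ) (a : ι → ℂ) (lam : ι → ℝ) :
    Prop where
  injective : Function.Injective lam
  ne_zero : ∀ i, a i ≠ 0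
  coeff : ∀ i, HasDirichletCoeff α β f (lam i) (a i)
  coeff_eq_zero : ∀ x, x ∉ range lam → HasDirichletCoeff α β f x 0

/-- The quantity `|a i| e ^ (σ lam i)` in `[0, ∞]`, for `σ` in `[-∞, ∞]`, with `e ^ (-∞) = 0` and
`e ^ ∞ = ∞`. -/
def absTerm {ι : Type*} (a : ι → ℂ) (lam : ι → ℝ) (σ : EReal) (i : ι) : ENNReal :=
  ‖a i‖ₑ * EReal.exp (σ * (lam i : EReal))

/-- The set `R_f`: the closure in `ℝ` of the set of real parts of the zeros of `f` in the strip,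
intersected with `(α, β)`. -/
def zeroProj (α β : EReal) (f : ℂ → ℂ) : Set ℝ :=
  closure (Complex.re '' {s | s ∈ strip α β ∧ f s = 0}) ∩
    {σ : ℝ | α < (σ : EReal) ∧ (σ : EReal) < β}

end APStrip

end

/-! Write r_i(σ) = |a_i| e^{λ_i σ}. The theorem reduces to finding one real σ in (α, β) at which no
r_i(σ) exceeds the sum of the others.

Independence of the exponents makes the series converge absolutely: testing f on a vertical line
against Riesz products bounds every finite sum of r_i(σ) by twice the supremum of |f| there
(`sum_norm_coeff_le`). By Bohr's uniqueness theorem (`IsAP.eq_zero`), f is the sum of its Dirichlet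
series in the strip (`IsDirichletSeries.eq_tsum`).

The hypothesis at an endpoint yields σ by convexity. If some term dominated at every σ near the
endpoint, the whole sum would be less than twice one term, hence less than twice a linear
interpolation between bounds at the endpoint and at an interior point; in the limit this contradicts
the hypothesis (`exists_no_dominant_term_left`).

At such a σ the lengths r_i(σ) close up to a polygon (`exists_phases_tsum_eq_zero`), so the series
with suitably rotated coefficients vanishes at σ. By Kronecker's theorem, vertical translates of f
approximate the rotated series uniformly on a thin strip, and a Hurwitz argument transfers the zero
to f (`exists_zero_of_rotated_zero`). -/

namespace APStrip

/-! ### Bohr almost periodic functions on the line -/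

/-- Bohr almost periodic functions on the real line. -/
def IsAP (u : ℝ → ℂ) : Prop :=
  Continuous u ∧ ∀ ε : ℝ, 0 < ε → ∃ l : ℝ, 0 < l ∧ ∀ t₀ : ℝ, ∃ τ ∈ Ioo t₀ (t₀ + l),
    ∀ t : ℝ, ‖u (t + τ) - u t‖ ≤ ε

namespace IsAP

theorem exists_bound {u : ℝ → ℂ} (hu : IsAP u) : ∃ C : ℝ, 0 < C ∧ ∀ t, ‖u t‖ ≤ C := by
  obtain ⟨l, hl, h⟩ := hu.2 1 one_pos
  obtain ⟨C, hC⟩ := (isCompact_Icc (a := (0 : ℝ)) (b := l)).exists_bound_of_continuousOn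
    hu.1.continuousOn
  have hC0 : 0 ≤ C := (norm_nonneg _).trans (hC 0 ⟨le_rfl, hl.le⟩)
  refine ⟨C + 1, by linarith, fun t => ?_⟩
  obtain ⟨τ, hτ, h'⟩ := h (-t)
  have h1 := hC (t + τ) ⟨by linarith [hτ.1], by linarith [hτ.2]⟩
  have h2 := norm_sub_norm_le (u t) (u (t + τ))
  rw [norm_sub_rev] at h2
  linarith [h' t]

theorem uniformContinuous {u : ℝ → ℂ} (hu : IsAP u) : UniformContinuous u := by
  rw [Metric.uniformContinuous_iff]
  intro ε hε
  obtain ⟨l, hl, h⟩ := hu.2 (ε / 4) (by linarith)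
  have huc := (isCompact_Icc (a := (-1 : ℝ)) (b := l + 1)).uniformContinuousOn_of_continuous
    hu.1.continuousOn
  rw [Metric.uniformContinuousOn_iff] at huc
  obtain ⟨δ, hδ, huc⟩ := huc (ε / 4) (by linarith)
  -- The cap 1 keeps both translated points inside [-1, l + 1], where compactness gives uniform
  -- continuity.
  refine ⟨min δ 1, lt_min hδ one_pos, fun {s t} hst => ?_⟩
  obtain ⟨τ, hτ, h'⟩ := h (-t)
  rw [Real.dist_eq] at hst
  have hst1 := hst.trans_le (min_le_left _ _)
  have hst2 := abs_lt.1 (hst.trans_le (min_le_right _ _))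
  have h1 := huc (s + τ) ⟨by linarith [hτ.1], by linarith [hτ.2]⟩ (t + τ)
    ⟨by linarith [hτ.1], by linarith [hτ.2]⟩ (by rw [Real.dist_eq]; simpa using hst1)
  rw [dist_eq_norm] at h1 ⊢
  have e : u s - u t = -(u (s + τ) - u s) + (u (s + τ) - u (t + τ)) + (u (t + τ) - u t) := by ring
  rw [e]
  refine (norm_add₃_le).trans_lt ?_
  rw [norm_neg]
  linarith [h' s, h' t]

/-- Total boundedness of the set of translates (Bochner): subtracting a translation number reduces
any t to [0, l], where uniform continuity lets a finite net suffice. -/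
theorem exists_finite_translates {u : ℝ → ℂ} (hu : IsAP u) {ε : ℝ} (hε : 0 < ε) :
    ∃ S : Set ℝ, S.Finite ∧ ∀ t, ∃ s ∈ S, ∀ x, ‖u (x + t) - u (x + s)‖ ≤ ε := by
  obtain ⟨l, hl, h⟩ := hu.2 (ε / 2) (by linarith)
  obtain ⟨δ, hδ, huc⟩ := Metric.uniformContinuous_iff.1 hu.uniformContinuous (ε / 2) (by linarith)
  obtain ⟨S, -, hS, hcov⟩ := (isCompact_Icc (a := (0 : ℝ)) (b := l)).finite_cover_balls hδ
  refine ⟨S, hS, fun t => ?_⟩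
  obtain ⟨τ, hτ, h'⟩ := h (t - l)
  have := hcov (show t - τ ∈ Icc 0 l from ⟨by linarith [hτ.2], by linarith [hτ.1]⟩)
  simp only [mem_iUnion, Metric.mem_ball] at this
  obtain ⟨s, hs, hd⟩ := this
  refine ⟨s, hs, fun x => ?_⟩
  have h1 := h' (x + (t - τ))
  have h2 := huc (a := x + (t - τ)) (b := x + s) (by simpa using hd)
  rw [dist_eq_norm] at h2
  rw [show x + (t - τ) + τ = x + t by ring] at h1
  have e : u (x + t) - u (x + s) = (u (x + t) - u (x + (t - τ))) + (u (x + (t - τ)) - u (x + s)) := by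
    ring
  rw [e]
  exact (norm_add_le _ _).trans (by linarith)

/-- Pigeonhole on pairs of net points: if t and r fall in the same class for both functions, then t
- r is a translation number of both. Fixing one representative r per class bounds |r|, which gives
relative density. Closure under sums and products rests on this. -/
theorem exists_common {u v : ℝ → ℂ} (hu : IsAP u) (hv : IsAP v) {ε : ℝ} (hε : 0 < ε) :
    ∃ l : ℝ, 0 < l ∧ ∀ t₀ : ℝ, ∃ τ ∈ Ioo t₀ (t₀ + l),
      (∀ t : ℝ, ‖u (t + τ) - u t‖ ≤ ε) ∧ ∀ t : ℝ, ‖v (t + τ) - v t‖ ≤ ε := by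
  classical
  obtain ⟨S, hS, hSu⟩ := hu.exists_finite_translates (half_pos hε)
  obtain ⟨S', hS', hSv⟩ := hv.exists_finite_translates (half_pos hε)
  let Q : ℝ × ℝ → ℝ → Prop := fun p t =>
    (∀ x, ‖u (x + t) - u (x + p.1)‖ ≤ ε / 2) ∧ ∀ x, ‖v (x + t) - v (x + p.2)‖ ≤ ε / 2
  -- Empty classes receive the irrelevant representative 0.
  have hr : ∀ p, ∃ r, (∃ t, Q p t) → Q p r := fun p => by
    by_cases hp : ∃ t, Q p t
    · exact ⟨hp.choose, fun _ => hp.choose_spec⟩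
    · exact ⟨0, fun h => absurd h hp⟩
  choose r hr using hr
  obtain ⟨R, hR⟩ := (((hS.prod hS').image r).image fun x => |x|).bddAbove
  have hR' : ∀ p ∈ S ×ˢ S', |r p| ≤ |R| := fun p hp =>
    (hR ⟨r p, ⟨p, hp, rfl⟩, rfl⟩).trans (le_abs_self R)
  refine ⟨2 * |R| + 1, by positivity, fun t₀ => ?_⟩
  set t := t₀ + |R| + 1 / 2 with ht
  obtain ⟨s, hs, h1⟩ := hSu t
  obtain ⟨s', hs', h2⟩ := hSv t
  have hq := hr (s, s') ⟨t, h1, h2⟩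
  have hb := abs_le.1 (hR' (s, s') ⟨hs, hs'⟩)
  refine ⟨t - r (s, s'), ⟨by linarith [hb.2], by linarith [hb.1]⟩, ?_, ?_⟩
  · intro x
    have a1 := h1 (x - r (s, s'))
    have a2 := hq.1 (x - r (s, s'))
    have e : u (x + (t - r (s, s'))) - u x = (u (x - r (s, s') + t) - u (x - r (s, s') + s)) -
        (u (x - r (s, s') + r (s, s')) - u (x - r (s, s') + s)) := by
      ring_nf
    rw [e]
    exact (norm_sub_le _ _).trans (by linarith)
  · intro x
    have a1 := h2 (x - r (s, s'))
    have a2 := hq.2 (x - r (s, s'))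
    have e : v (x + (t - r (s, s'))) - v x = (v (x - r (s, s') + t) - v (x - r (s, s') + s')) -
        (v (x - r (s, s') + r (s, s')) - v (x - r (s, s') + s')) := by
      ring_nf
    rw [e]
    exact (norm_sub_le _ _).trans (by linarith)

theorem add {u v : ℝ → ℂ} (hu : IsAP u) (hv : IsAP v) : IsAP fun t => u t + v t := by
  refine ⟨hu.1.add hv.1, fun ε hε => ?_⟩
  obtain ⟨l, hl, h⟩ := hu.exists_common hv (half_pos hε)
  refine ⟨l, hl, fun t₀ => ?_⟩
  obtain ⟨τ, hτ, h1, h2⟩ := h t₀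
  refine ⟨τ, hτ, fun t => ?_⟩
  rw [add_sub_add_comm]
  exact (norm_add_le _ _).trans (by linarith [h1 t, h2 t])

theorem mul {u v : ℝ → ℂ} (hu : IsAP u) (hv : IsAP v) : IsAP fun t => u t * v t := by
  refine ⟨hu.1.mul hv.1, fun ε hε => ?_⟩
  obtain ⟨C, hC, hCu⟩ := hu.exists_bound
  obtain ⟨D, hD, hDv⟩ := hv.exists_bound
  obtain ⟨l, hl, h⟩ := hu.exists_common hv (ε := ε / (C + D)) (by positivity)
  refine ⟨l, hl, fun t₀ => ?_⟩
  obtain ⟨τ, hτ, h1, h2⟩ := h t₀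
  refine ⟨τ, hτ, fun t => ?_⟩
  have e : u (t + τ) * v (t + τ) - u t * v t =
      u (t + τ) * (v (t + τ) - v t) + (u (t + τ) - u t) * v t := by ring
  rw [e]
  refine (norm_add_le _ _).trans ?_
  rw [norm_mul, norm_mul]
  have a1 := mul_le_mul (hCu (t + τ)) (h2 t) (norm_nonneg _) hC.le
  have a2 := mul_le_mul (h1 t) (hDv t) (norm_nonneg _) (by positivity)
  have : C * (ε / (C + D)) + ε / (C + D) * D = ε := by field_simp
  linarith

theorem const (c : ℂ) : IsAP fun _ => c :=
  ⟨continuous_const, fun ε hε => ⟨1, one_pos, fun t₀ => ⟨t₀ + 1 / 2, ⟨by linarith, by linarith⟩,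
    fun _ => by simpa using hε.le⟩⟩⟩

theorem exp (x : ℝ) : IsAP fun t => Complex.exp (x * t * Complex.I) := by
  rcases eq_or_ne x 0 with rfl | hx
  · simpa using const 1
  refine ⟨by fun_prop, fun ε hε => ?_⟩
  set p := 2 * Real.pi / |x| with hp
  have hp0 : 0 < p := by have := Real.pi_pos; positivity
  have hper : ∀ t : ℝ, ∀ n : ℤ, Complex.exp (x * (t + n * p : ℝ) * Complex.I) =
      Complex.exp (x * t * Complex.I) := by
    intro t n
    have hpx : ∃ m : ℤ, (x : ℝ) * (n * p) = m * (2 * Real.pi) := by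
      rcases abs_choice x with h | h
      · exact ⟨n, by rw [hp, h]; field_simp⟩
      · refine ⟨-n, ?_⟩
        rw [hp, h]
        push_cast
        field_simp
    obtain ⟨m, hm⟩ := hpx
    rw [Complex.exp_eq_exp_iff_exists_int]
    refine ⟨m, ?_⟩
    have hm' : (x : ℂ) * (n * p) = m * (2 * Real.pi) := by exact_mod_cast hm
    push_cast
    linear_combination Complex.I * hm'
  refine ⟨2 * p, by positivity, fun t₀ => ⟨(⌊t₀ / p⌋ + 1 : ℤ) * p, ⟨?_, ?_⟩, fun t => ?_⟩⟩
  · have := Int.lt_floor_add_one (t₀ / p)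
    rw [div_lt_iff₀ hp0] at this
    push_cast
    exact this
  · have := Int.floor_le (t₀ / p)
    rw [le_div_iff₀ hp0] at this
    push_cast
    linarith
  · beta_reduce
    rw [hper]
    simpa using hε.le

theorem neg {u : ℝ → ℂ} (hu : IsAP u) : IsAP fun t => -u t := by
  simpa using (const (-1)).mul hu

theorem sub {u v : ℝ → ℂ} (hu : IsAP u) (hv : IsAP v) : IsAP fun t => u t - v t := by
  simpa [sub_eq_add_neg] using hu.add hv.neg

theorem sum {ι : Type*} (s : Finset ι) {u : ι → ℝ → ℂ} (hu : ∀ i ∈ s, IsAP (u i)) :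
    IsAP fun t => ∑ i ∈ s, u i t := by
  classical
  induction s using Finset.induction_on with
  | empty => simpa using const 0
  | insert i s hi ih =>
    simp only [Finset.sum_insert hi]
    exact (hu i (by simp)).add (ih fun j hj => hu j (by simp [hj]))

theorem of_uniform_limit {u : ℝ → ℂ}
    (h : ∀ ε : ℝ, 0 < ε → ∃ v : ℝ → ℂ, IsAP v ∧ ∀ t, ‖u t - v t‖ ≤ ε) : IsAP u := by
  have key : ∀ ε : ℝ, 0 < ε → ∃ v : ℝ → ℂ, IsAP v ∧ ∀ s t, ‖u s - u t‖ ≤ ‖v s - v t‖ + ε := by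
    intro ε hε
    obtain ⟨v, hv, hd⟩ := h (ε / 2) (half_pos hε)
    refine ⟨v, hv, fun s t => ?_⟩
    have e : u s - u t = (u s - v s) + (v s - v t) - (u t - v t) := by ring
    rw [e]
    have := norm_sub_le ((u s - v s) + (v s - v t)) (u t - v t)
    have := norm_add_le (u s - v s) (v s - v t)
    linarith [hd s, hd t]
  constructor
  · rw [Metric.continuous_iff]
    intro t ε hε
    obtain ⟨v, hv, hd⟩ := key (ε / 2) (half_pos hε)
    obtain ⟨δ, hδ, hc⟩ := Metric.continuous_iff.1 hv.1 t (ε / 2) (half_pos hε)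
    refine ⟨δ, hδ, fun s hs => ?_⟩
    have := hc s hs
    rw [dist_eq_norm] at this ⊢
    linarith [hd s t]
  · intro ε hε
    obtain ⟨v, hv, hd⟩ := key (ε / 2) (half_pos hε)
    obtain ⟨l, hl, hτ⟩ := hv.2 (ε / 2) (half_pos hε)
    refine ⟨l, hl, fun t₀ => ?_⟩
    obtain ⟨τ, h1, h2⟩ := hτ t₀
    exact ⟨τ, h1, fun t => by linarith [hd (t + τ) t, h2 t]⟩

/-- Absolutely convergent trigonometric series are almost periodic. -/
theorem tsum_exp {ι : Type*} {b : ι → ℂ} (hb : Summable fun i => ‖b i‖) (lam : ι → ℝ) :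
    IsAP fun t => ∑' i, b i * Complex.exp (lam i * t * Complex.I) := by
  have hn : ∀ i (t : ℝ), ‖b i * Complex.exp (lam i * t * Complex.I)‖ = ‖b i‖ := fun i t => by
    rw [norm_mul, ← Complex.ofReal_mul, Complex.norm_exp_ofReal_mul_I, mul_one]
  refine of_uniform_limit fun ε hε => ?_
  have hu := tendstoUniformly_tsum (f := fun i (t : ℝ) => b i * Complex.exp (lam i * t * Complex.I))
    hb fun i t => (hn i t).le
  rw [Metric.tendstoUniformly_iff] at hu
  obtain ⟨s, hs⟩ := (hu ε hε).exists
  refine ⟨_, sum s fun i _ => (const (b i)).mul (exp (lam i)), fun t => ?_⟩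
  have := hs t
  rw [dist_eq_norm] at this
  exact this.le

end IsAP

/-! ### Mean values -/

/-- `c` is the mean value of `u` over the symmetric intervals `[-T, T]`. -/
def HasMean (u : ℝ → ℂ) (c : ℂ) : Prop :=
  Tendsto (fun T : ℝ => ((2 * T)⁻¹ : ℝ) • ∫ t in (-T)..T, u t) atTop (𝓝 c)

namespace HasMean

theorem unique {u : ℝ → ℂ} {c d : ℂ} (h : HasMean u c) (h' : HasMean u d) : c = d :=
  tendsto_nhds_unique h h'

theorem zero : HasMean (fun _ => 0) 0 := by simp [HasMean]

theorem const_mul {u : ℝ → ℂ} {c : ℂ} (h : HasMean u c) (k : ℂ) :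
    HasMean (fun t => k * u t) (k * c) := by
  refine (Tendsto.const_mul k h).congr fun T => ?_
  rw [intervalIntegral.integral_const_mul, mul_smul_comm]

theorem sub {u v : ℝ → ℂ} {c d : ℂ} (hu : Continuous u) (hv : Continuous v)
    (h : HasMean u c) (h' : HasMean v d) : HasMean (fun t => u t - v t) (c - d) := by
  refine (Tendsto.sub h h').congr fun T => ?_
  rw [intervalIntegral.integral_sub (hu.intervalIntegrable _ _) (hv.intervalIntegrable _ _),
    smul_sub]

theorem sum {ι : Type*} (s : Finset ι) {u : ι → ℝ → ℂ} {c : ι → ℂ}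
    (hu : ∀ i ∈ s, Continuous (u i)) (h : ∀ i ∈ s, HasMean (u i) (c i)) :
    HasMean (fun t => ∑ i ∈ s, u i t) (∑ i ∈ s, c i) := by
  refine (tendsto_finsetSum s h).congr fun T => ?_
  rw [intervalIntegral.integral_finsetSum fun i hi => (hu i hi).intervalIntegrable _ _,
    Finset.smul_sum]

theorem norm_mean_le {u w : ℝ → ℂ} (hw : Continuous w) {T : ℝ} (hT : 0 < T)
    (h : ∀ t, ‖u t‖ ≤ (w t).re) :
    ‖((2 * T)⁻¹ : ℝ) • ∫ t in (-T)..T, u t‖ ≤ (((2 * T)⁻¹ : ℝ) • ∫ t in (-T)..T, w t).re := by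
  have h0 : 0 ≤ (2 * T)⁻¹ := by positivity
  rw [norm_smul, Real.norm_of_nonneg h0, Complex.smul_re, smul_eq_mul]
  refine mul_le_mul_of_nonneg_left ?_ h0
  have e : (∫ t in (-T)..T, w t).re = ∫ t in (-T)..T, (w t).re := by
    simpa using (Complex.reCLM.intervalIntegral_comp_comm (hw.intervalIntegrable (-T) T)).symm
  rw [e]
  exact intervalIntegral.norm_integral_le_of_norm_le (by linarith)
    (Eventually.of_forall fun t _ => h t)
    ((Complex.continuous_re.comp hw).intervalIntegrable _ _)

/-- The majorant is complex-valued, with only its real part compared, so that `HasMean` applies to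
both functions. It serves to compare means against nonnegative kernels. -/
theorem norm_le_re {u w : ℝ → ℂ} {c d : ℂ} (hw : Continuous w)
    (h : HasMean u c) (h' : HasMean w d) (hle : ∀ t, ‖u t‖ ≤ (w t).re) : ‖c‖ ≤ d.re := by
  refine le_of_tendsto_of_tendsto h.norm ((Complex.continuous_re.tendsto d).comp h') ?_
  filter_upwards [eventually_gt_atTop 0] with T hT
  exact norm_mean_le hw hT hle

theorem exp (x : ℝ) : HasMean (fun t => Complex.exp (x * t * Complex.I)) (if x = 0 then 1 else 0) := by
  split_ifs with hx
  · subst hx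
    refine tendsto_const_nhds.congr' ?_
    filter_upwards [eventually_gt_atTop 0] with T hT
    have : (T : ℂ) ≠ 0 := by exact_mod_cast hT.ne'
    simp
    field_simp
    norm_num
  · have hxI : (x * Complex.I : ℂ) ≠ 0 := by simp [hx]
    have hb : ∀ T : ℝ, ‖∫ t in (-T)..T, Complex.exp (x * t * Complex.I)‖ ≤ 2 / |x| := by
      intro T
      have e : ∀ t : ℝ, Complex.exp (x * t * Complex.I) = Complex.exp (x * Complex.I * t) :=
        fun t => by ring_nf
      simp_rw [e]
      rw [integral_exp_mul_complex hxI, norm_div]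
      have hn : ∀ t : ℝ, ‖Complex.exp (x * Complex.I * t)‖ = 1 := fun t => by
        rw [← e, ← Complex.ofReal_mul, Complex.norm_exp_ofReal_mul_I]
      have := norm_sub_le (Complex.exp (x * Complex.I * T))
        (Complex.exp (x * Complex.I * ((-T : ℝ) : ℂ)))
      rw [hn, hn] at this
      simp only [norm_mul, Complex.norm_I, mul_one, Complex.norm_real, Real.norm_eq_abs]
      gcongr
      linarith
    have h0 : Tendsto (fun T : ℝ => ((2 * T)⁻¹ : ℝ)) atTop (𝓝 0) :=
      (tendsto_id.const_mul_atTop two_pos).inv_tendsto_atTop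
    refine h0.zero_smul_isBoundedUnder_le ?_
    exact isBoundedUnder_of ⟨2 / |x|, hb⟩

end HasMean

/-! ### Products of trigonometric polynomials and Kronecker's theorem -/

theorem continuous_cexp_mul_I (x : ℝ) :
    Continuous fun t : ℝ => Complex.exp (x * t * Complex.I) := by fun_prop

/-- The mean value of a function against a product of trigonometric polynomials. -/
theorem HasMean.mul_prod {J κ : Type*} [Fintype J] [DecidableEq J] {u : ℝ → ℂ} (hu : Continuous u)
    {m : ℝ → ℂ} (hm : ∀ x : ℝ, HasMean (fun t => u t * Complex.exp (x * t * Complex.I)) (m x))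
    (lam : J → ℝ) (K : J → Finset κ) (c : J → κ → ℂ) (e : J → κ → ℤ) :
    HasMean (fun t => u t * ∏ j, ∑ k ∈ K j, c j k * Complex.exp (e j k * (lam j * t * Complex.I)))
      (∑ p ∈ Fintype.piFinset K, (∏ j, c j (p j)) * m (∑ j, e j (p j) * lam j)) := by
  have h := HasMean.sum (Fintype.piFinset K)
    (u := fun p t => (∏ j, c j (p j)) *
      (u t * Complex.exp ((∑ j, e j (p j) * lam j : ℝ) * t * Complex.I)))
    (fun p _ => continuous_const.mul (hu.mul (continuous_cexp_mul_I _)))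
    fun p _ => (hm (∑ j, e j (p j) * lam j)).const_mul (∏ j, c j (p j))
  convert h using 2 with t
  rw [Finset.prod_univ_sum, Finset.mul_sum]
  refine Finset.sum_congr rfl fun p _ => ?_
  rw [Finset.prod_mul_distrib, ← Complex.exp_sum]
  push_cast
  rw [Finset.sum_mul, Finset.sum_mul]
  simp only [mul_assoc]
  ring

theorem sum_int_mul_eq_zero_iff {J : Type*} [Fintype J] {lam : J → ℝ}
    (hlin : LinearIndependent ℚ lam) (n : J → ℤ) : ∑ j, n j * lam j = 0 ↔ ∀ j, n j = 0 := by
  refine ⟨fun h j => ?_, fun h => by simp [h]⟩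
  have := Fintype.linearIndependent_iff.1 hlin (fun j => (n j : ℚ)) (by
    simpa [Algebra.smul_def] using h) j
  exact_mod_cast this

/-- For independent exponents a combined frequency vanishes only if each factor contributes
frequency zero. The factors thus behave like independent random variables: the mean of the product
is the product of the constant coefficients. -/
theorem hasMean_prod {J κ : Type*} [Fintype J] [DecidableEq J] {lam : J → ℝ}
    (hlin : LinearIndependent ℚ lam) (K : J → Finset κ) (c : J → κ → ℂ) (e : J → κ → ℤ) :
    HasMean (fun t => ∏ j, ∑ k ∈ K j, c j k * Complex.exp (e j k * (lam j * t * Complex.I)))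
      (∏ j, ∑ k ∈ K j with e j k = 0, c j k) := by
  have h := HasMean.mul_prod (u := fun _ => 1) continuous_const
    (m := fun x => if x = 0 then 1 else 0) (fun x => by simpa using HasMean.exp x) lam K c e
  simp only [one_mul] at h
  convert h using 1
  rw [Finset.prod_univ_sum]
  simp only [mul_ite, mul_one, mul_zero, ← Finset.sum_filter, sum_int_mul_eq_zero_iff hlin]
  refine Finset.sum_congr ?_ fun _ _ => rfl
  ext p
  simp [Fintype.mem_piFinset, forall_and]

/-- `p` is a trigonometric polynomial with integer frequencies and constant coefficient `c₀`. -/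
def IsTrigPoly (p : ℝ → ℂ) (c₀ : ℂ) : Prop :=
  ∃ (K : Finset (ℕ × ℕ)) (c : ℕ × ℕ → ℂ) (e : ℕ × ℕ → ℤ),
    (∀ w : ℝ, p w = ∑ k ∈ K, c k * Complex.exp (e k * (w * Complex.I))) ∧
      c₀ = ∑ k ∈ K with e k = 0, c k

theorem IsTrigPoly.continuous {p : ℝ → ℂ} {c₀ : ℂ} (h : IsTrigPoly p c₀) : Continuous p := by
  obtain ⟨K, c, e, hp, -⟩ := h
  rw [funext hp]
  fun_prop

theorem IsTrigPoly.hasMean_prod {J : Type*} [Fintype J] [DecidableEq J] {lam : J → ℝ}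
    (hlin : LinearIndependent ℚ lam) {p : J → ℝ → ℂ} {c₀ : J → ℂ}
    (hp : ∀ j, IsTrigPoly (p j) (c₀ j)) : HasMean (fun t => ∏ j, p j (lam j * t)) (∏ j, c₀ j) := by
  choose K c e hp hc using hp
  convert APStrip.hasMean_prod hlin K c e using 2 with t
  · refine Finset.prod_congr rfl fun j _ => ?_
    rw [hp]
    push_cast
    rfl
  · exact hc _

/-- The unnormalized Fejér kernel centred at θ: only the N diagonal pairs of the double sum have
frequency zero. -/
theorem isTrigPoly_fejer (N : ℕ) (θ : ℝ) :
    IsTrigPoly (fun w => ((‖∑ k ∈ Finset.range N, Complex.exp ((w - θ : ℝ) * Complex.I) ^ k‖ ^ 2 : ℝ)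
      : ℂ)) N := by
  refine ⟨Finset.range N ×ˢ Finset.range N,
    fun k => Complex.exp (-(((k.1 : ℤ) - (k.2 : ℤ) : ℤ) * (θ * Complex.I))),
    fun k => (k.1 : ℤ) - (k.2 : ℤ), fun w => ?_, ?_⟩
  · beta_reduce
    rw [Complex.ofReal_pow, ← Complex.mul_conj', map_sum, Finset.sum_mul_sum, Finset.sum_product]
    refine Finset.sum_congr rfl fun k _ => Finset.sum_congr rfl fun l _ => ?_
    rw [map_pow, ← Complex.exp_conj, ← Complex.exp_nat_mul, ← Complex.exp_nat_mul,
      ← Complex.exp_add, ← Complex.exp_add]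
    congr 1
    simp
    ring
  · have h1 : ∀ k ∈ (Finset.range N ×ˢ Finset.range N).filter
        (fun k : ℕ × ℕ => ((k.1 : ℤ) - (k.2 : ℤ)) = 0),
        Complex.exp (-(((k.1 : ℤ) - (k.2 : ℤ) : ℤ) * (θ * Complex.I))) = 1 := fun k hk => by
      rw [(Finset.mem_filter.1 hk).2]
      simp
    have h2 : (Finset.range N ×ˢ Finset.range N).filter
        (fun k : ℕ × ℕ => ((k.1 : ℤ) - (k.2 : ℤ)) = 0) = (Finset.range N).diag := by
      ext ⟨a, b⟩
      simp only [Finset.mem_filter, Finset.mem_product, Finset.mem_range, Finset.mem_diag]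
      omega
    rw [Finset.sum_congr rfl h1, h2]
    simp [Finset.diag_card]

/-- This is the Fejér kernel multiplied by |1 - z|²; its constant coefficient is 2 however large N
is, so the Fejér kernel concentrates at z = 1. -/
theorem isTrigPoly_one_sub_pow {N : ℕ} (hN : N ≠ 0) (θ : ℝ) :
    IsTrigPoly (fun w => ((‖1 - Complex.exp ((w - θ : ℝ) * Complex.I) ^ N‖ ^ 2 : ℝ) : ℂ)) 2 := by
  refine ⟨Finset.range 2 ×ˢ Finset.range 2,
    fun k => (-1) ^ (k.1 + k.2) * Complex.exp (-((N * ((k.1 : ℤ) - (k.2 : ℤ)) : ℤ) * (θ * Complex.I))),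
    fun k => N * ((k.1 : ℤ) - (k.2 : ℤ)), fun w => ?_, ?_⟩
  · have hz : ∀ n : ℤ, Complex.exp (-(n * (θ * Complex.I))) * Complex.exp (n * (w * Complex.I)) =
        Complex.exp (n * ((w - θ : ℝ) * Complex.I)) := fun n => by
      rw [← Complex.exp_add]
      congr 1
      push_cast
      ring
    simp_rw [mul_assoc, hz]
    have h1 : Complex.exp ((w - θ : ℝ) * Complex.I) ^ N =
        Complex.exp (N * ((w - θ : ℝ) * Complex.I)) := (Complex.exp_nat_mul _ _).symm
    have h2 : (starRingEnd ℂ) (Complex.exp (N * ((w - θ : ℝ) * Complex.I))) =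
        Complex.exp (-(N * ((w - θ : ℝ) * Complex.I))) := by
      rw [← Complex.exp_conj]
      congr 1
      simp
    have h3 : Complex.exp (N * ((w - θ : ℝ) * Complex.I)) *
        Complex.exp (-(N * ((w - θ : ℝ) * Complex.I))) = 1 := by
      rw [← Complex.exp_add, add_neg_cancel, Complex.exp_zero]
    rw [Complex.ofReal_pow, ← Complex.mul_conj', map_sub, map_one, h1, h2, Finset.sum_product]
    simp only [Finset.sum_range_succ, Finset.sum_range_zero, zero_add]
    have e1 : ((N * (((0 : ℕ) : ℤ) - ((1 : ℕ) : ℤ)) : ℤ) : ℂ) * ((w - θ : ℝ) * Complex.I) =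
        -(N * ((w - θ : ℝ) * Complex.I)) := by push_cast; ring
    have e2 : ((N * (((1 : ℕ) : ℤ) - ((0 : ℕ) : ℤ)) : ℤ) : ℂ) * ((w - θ : ℝ) * Complex.I) =
        N * ((w - θ : ℝ) * Complex.I) := by push_cast; ring
    rw [e1, e2]
    simp only [sub_self, mul_zero, Int.cast_zero, zero_mul, Complex.exp_zero]
    linear_combination h3
  · simp [Finset.sum_filter, Finset.sum_product, Finset.sum_range_succ, hN]
    norm_num

/-- Kronecker's theorem on simultaneous approximation by a one-parameter flow. -/
theorem exists_forall_norm_exp_sub_le {J : Type*} [Fintype J] {lam : J → ℝ}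
    (hlin : LinearIndependent ℚ lam) (θ : J → ℝ) {ε : ℝ} (hε : 0 < ε) :
    ∃ t : ℝ, ∀ j, ‖Complex.exp (lam j * t * Complex.I) - Complex.exp (θ j * Complex.I)‖ ≤ ε := by
  classical
  by_contra! hcon
  -- If at every t some coordinate is farther than ε from its target, then ε² ∏ D_j ≤ ∑_i |1 - z_i|²
  -- ∏ D_j. Taking means gives ε² N^|J| ≤ 2|J| N^(|J|-1), which this N contradicts.
  obtain ⟨N, hN⟩ := exists_nat_gt (2 * Fintype.card J / ε ^ 2)
  have hN0 : N ≠ 0 := by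
    rintro rfl
    have : 0 ≤ 2 * Fintype.card J / ε ^ 2 := by positivity
    push_cast at hN
    linarith
  have hNpos : (0 : ℝ) < N := by positivity
  set D : J → ℝ → ℂ := fun j w =>
    ((‖∑ k ∈ Finset.range N, Complex.exp ((w - θ j : ℝ) * Complex.I) ^ k‖ ^ 2 : ℝ) : ℂ) with hD
  set E : J → ℝ → ℂ := fun j w =>
    ((‖1 - Complex.exp ((w - θ j : ℝ) * Complex.I) ^ N‖ ^ 2 : ℝ) : ℂ) with hE
  have hDt : ∀ j, IsTrigPoly (D j) N := fun j => isTrigPoly_fejer N (θ j)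
  have hEt : ∀ j, IsTrigPoly (E j) 2 := fun j => isTrigPoly_one_sub_pow hN0 (θ j)
  have hQt : ∀ i j, IsTrigPoly (if j = i then E j else D j) (if j = i then 2 else N) := by
    intro i j
    split_ifs
    · exact hEt j
    · exact hDt j
  have h1 : HasMean (fun t => ((ε ^ 2 : ℝ) : ℂ) * ∏ j, D j (lam j * t))
      ((ε ^ 2 : ℝ) * ∏ _j : J, (N : ℂ)) :=
    (IsTrigPoly.hasMean_prod hlin hDt).const_mul _
  have hcont : ∀ i, Continuous fun t : ℝ => ∏ j, (if j = i then E j else D j) (lam j * t) :=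
    fun i => continuous_finsetProd _ fun j _ => (hQt i j).continuous.comp (by fun_prop)
  have h2 := HasMean.sum Finset.univ (fun i _ => hcont i)
    fun i _ => IsTrigPoly.hasMean_prod hlin (hQt i)
  -- The geometric sum turns |1 - z|² times the i-th Fejér kernel into |1 - z^N|².
  have hmul : ∀ i t, (∏ j, (if j = i then E j else D j) (lam j * t)) =
      ((‖1 - Complex.exp ((lam i * t - θ i : ℝ) * Complex.I)‖ ^ 2 : ℝ) : ℂ) *
        ∏ j, D j (lam j * t) := by
    intro i t
    rw [← Finset.mul_prod_erase _ _ (Finset.mem_univ i),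
      ← Finset.mul_prod_erase _ (fun j => D j (lam j * t)) (Finset.mem_univ i), ← mul_assoc, if_pos rfl]
    congr 1
    · simp only [hD, hE, ← Complex.ofReal_mul, ← mul_pow, ← norm_mul, mul_neg_geom_sum]
    · exact Finset.prod_congr rfl fun j hj => by rw [if_neg (Finset.ne_of_mem_erase hj)]
  have hDr : ∀ t, ∃ r : ℝ, 0 ≤ r ∧ ∏ j, D j (lam j * t) = (r : ℂ) := fun t =>
    ⟨∏ j, ‖∑ k ∈ Finset.range N, Complex.exp ((lam j * t - θ j : ℝ) * Complex.I) ^ k‖ ^ 2,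
      by positivity, by rw [Complex.ofReal_prod]⟩
  have h3 := h1.norm_le_re (continuous_finsetSum _ fun i _ => hcont i) h2 fun t => by
    obtain ⟨r, hr0, hr⟩ := hDr t
    obtain ⟨i, hi⟩ := hcon t
    simp only [hmul, hr]
    rw [← Finset.sum_mul, ← Complex.ofReal_sum, ← Complex.ofReal_mul, ← Complex.ofReal_mul,
      Complex.ofReal_re, Complex.norm_real, Real.norm_of_nonneg (by positivity)]
    refine mul_le_mul_of_nonneg_right ?_ hr0
    refine le_trans ?_ (Finset.single_le_sum (f := fun i =>
      ‖1 - Complex.exp ((lam i * t - θ i : ℝ) * Complex.I)‖ ^ 2) (fun i _ => by positivity)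
      (Finset.mem_univ i))
    have e : Complex.exp (lam i * t * Complex.I) - Complex.exp (θ i * Complex.I) =
        -(Complex.exp (θ i * Complex.I) * (1 - Complex.exp ((lam i * t - θ i : ℝ) * Complex.I))) := by
      rw [mul_sub, ← Complex.exp_add]
      push_cast
      ring_nf
    rw [e, norm_neg, norm_mul, Complex.norm_exp_ofReal_mul_I, one_mul] at hi
    exact pow_le_pow_left₀ hε.le hi.le 2
  -- The negated claim at t = 0 shows that J is nonempty, so the natural subtraction |J| - 1 is
  -- genuine.
  obtain ⟨i₀, -⟩ := hcon 0
  have hcard : (Fintype.card J - 1) + 1 = Fintype.card J :=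
    Nat.sub_add_cancel (Fintype.card_pos_iff.2 ⟨i₀⟩)
  have hprod : ∀ i : J, (∏ j, if j = i then (2 : ℂ) else N) = 2 * N ^ (Fintype.card J - 1) := by
    intro i
    rw [← Finset.mul_prod_erase _ _ (Finset.mem_univ i), if_pos rfl,
      Finset.prod_congr rfl fun j hj => if_neg (Finset.ne_of_mem_erase hj)]
    simp
  simp only [hprod, Finset.prod_const, Finset.sum_const, Finset.card_univ, nsmul_eq_mul] at h3
  have h4 : ε ^ 2 * (N : ℝ) ^ Fintype.card J ≤
      Fintype.card J * (2 * (N : ℝ) ^ (Fintype.card J - 1)) := by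
    have e1 : ‖((ε ^ 2 : ℝ) : ℂ) * (N : ℂ) ^ Fintype.card J‖ = ε ^ 2 * (N : ℝ) ^ Fintype.card J := by
      rw [norm_mul, norm_pow, Complex.norm_real, Complex.norm_natCast,
        Real.norm_of_nonneg (by positivity)]
    have e2 : ((Fintype.card J : ℂ) * (2 * (N : ℂ) ^ (Fintype.card J - 1))).re =
        Fintype.card J * (2 * (N : ℝ) ^ (Fintype.card J - 1)) := by
      rw [← Complex.ofReal_re (Fintype.card J * (2 * (N : ℝ) ^ (Fintype.card J - 1)))]
      push_cast
      rfl
    rwa [e1, e2] at h3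
  rw [div_lt_iff₀ (by positivity)] at hN
  have h5 : (N : ℝ) ^ Fintype.card J = N * (N : ℝ) ^ (Fintype.card J - 1) := by
    rw [← pow_succ', hcard]
  rw [h5] at h4
  have : (0 : ℝ) < (N : ℝ) ^ (Fintype.card J - 1) := by positivity
  nlinarith

/-! ### Absolute summability of the coefficients by Riesz products -/

/-- The index i need not lie in F, so the relation is compared with a single basis vector among
finitely supported functions on all of ι, where independence is injectivity. -/
theorem eq_single_of_sum_mul_eq {ι : Type*} [DecidableEq ι] {lam : ι → ℝ} (hlin : LinearIndependent ℚ lam)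
    {F : Finset ι} {n : F → ℤ} {i : ι} (h : ∑ j, n j * lam j = lam i) :
    ∃ hi : i ∈ F, n = Pi.single ⟨i, hi⟩ 1 := by
  set q : ι →₀ ℚ := ∑ j : F, Finsupp.single (j : ι) (n j : ℚ) with hq
  have hq1 : Finsupp.linearCombination ℚ lam q = Finsupp.linearCombination ℚ lam (Finsupp.single i 1) := by
    simp only [hq, map_sum, Finsupp.linearCombination_single, one_smul]
    rw [← h]
    exact Finset.sum_congr rfl fun j _ => by simp [Algebra.smul_def]
  have hqe := hlin hq1
  have hval : ∀ j : F, q j = n j := fun j => by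
    rw [hq, Finsupp.finsetSum_apply, Finset.sum_eq_single j]
    · simp
    · intro k _ hk
      exact Finsupp.single_eq_of_ne fun hkj => hk (Subtype.ext hkj).symm
    · simp
  have hiF : i ∈ F := by
    by_contra hi
    have h0 : q i = 0 := by
      rw [hq, Finsupp.finsetSum_apply]
      refine Finset.sum_eq_zero fun k _ => Finsupp.single_eq_of_ne ?_
      rintro rfl
      exact hi k.2
    rw [hqe] at h0
    simp at h0
  refine ⟨hiF, funext fun j => ?_⟩
  have := hval j
  rw [hqe, Finsupp.single_apply] at this
  rw [Pi.single_apply]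
  by_cases hj : i = j
  · rw [if_pos hj] at this
    rw [if_pos (Subtype.ext hj.symm)]
    exact_mod_cast this.symm
  · rw [if_neg hj] at this
    rw [if_neg fun h => hj (congrArg Subtype.val h).symm]
    exact_mod_cast this.symm

theorem exists_norm_eq_one_mul_eq_norm (b : ℂ) : ∃ w : ℂ, ‖w‖ = 1 ∧ w * b = ‖b‖ := by
  rcases eq_or_ne b 0 with rfl | hb
  · exact ⟨1, by simp, by simp⟩
  · have hb' : (‖b‖ : ℂ) ≠ 0 := by simpa using hb
    refine ⟨(starRingEnd ℂ) b / ‖b‖, by simp [hb], ?_⟩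
    rw [div_mul_eq_mul_div, Complex.conj_mul']
    field_simp

/-- A bounded function whose frequencies are linearly independent has absolutely summable
Fourier coefficients. -/
theorem sum_norm_coeff_le {ι : Type*} {lam : ι → ℝ} (hlin : LinearIndependent ℚ lam)
    {u : ℝ → ℂ} (hu : Continuous u) {C : ℝ} (hC : ∀ t, ‖u t‖ ≤ C) {b : ι → ℂ} {m : ℝ → ℂ}
    (hm : ∀ x : ℝ, HasMean (fun t => u t * Complex.exp (x * t * Complex.I)) (m x))
    (hmb : ∀ i, m (-lam i) = b i) (hm0 : ∀ x, -x ∉ range lam → m x = 0) (F : Finset ι) :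
    ∑ i ∈ F, ‖b i‖ ≤ 2 * C := by
  classical
  choose w hw1 hwb using fun i => exists_norm_eq_one_mul_eq_norm (b i)
  -- These data encode the Riesz product ∏ (1 + Re(conj(w_j) e^{iλ_j t})). It is nonnegative with
  -- mean 1, and its mean against u is ∑ |b_i|/2, since each w_i was chosen with w_i b_i = |b_i|.
  -- Hence ∑ |b_i|/2 ≤ C.
  let K : F → Finset ℤ := fun _ => {-1, 0, 1}
  let c : F → ℤ → ℂ := fun j k =>
    if k = 0 then 1 else if k = -1 then w j / 2 else (starRingEnd ℂ) (w j) / 2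
  let e : F → ℤ → ℤ := fun _ k => k
  have hlinF : LinearIndependent ℚ fun j : F => lam j := hlin.comp _ Subtype.val_injective
  have hP : ∀ (j : F) (t : ℝ), ∑ k ∈ K j, c j k * Complex.exp (e j k * (lam j * t * Complex.I)) =
      ((1 + ((starRingEnd ℂ) (w j) * Complex.exp (lam j * t * Complex.I)).re : ℝ) : ℂ) := by
    intro j t
    have h1 : ∑ k ∈ K j, c j k * Complex.exp (e j k * (lam j * t * Complex.I)) =
        w j / 2 * Complex.exp (-(lam j * t * Complex.I)) +
          (1 + (starRingEnd ℂ) (w j) / 2 * Complex.exp (lam j * t * Complex.I)) := by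
      simp [K, c, e]
    have h2 : (starRingEnd ℂ) (Complex.exp (lam j * t * Complex.I)) =
        Complex.exp (-(lam j * t * Complex.I)) := by
      rw [← Complex.exp_conj]
      congr 1
      simp
    rw [h1, Complex.ofReal_add, Complex.ofReal_one, Complex.re_eq_add_conj, map_mul, h2,
      Complex.conj_conj]
    ring
  have hP0 : ∀ (j : F) (t : ℝ),
      0 ≤ 1 + ((starRingEnd ℂ) (w j) * Complex.exp (lam j * t * Complex.I)).re := by
    intro j t
    have := Complex.abs_re_le_norm ((starRingEnd ℂ) (w j) * Complex.exp (lam j * t * Complex.I))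
    rw [norm_mul, RCLike.norm_conj, hw1, ← Complex.ofReal_mul, Complex.norm_exp_ofReal_mul_I,
      mul_one, Complex.ofReal_mul] at this
    linarith [(abs_le.1 this).1]
  have hk := hasMean_prod hlinF K c e
  have huk := HasMean.mul_prod hu hm (fun j : F => lam j) K c e
  have hk1 : (∏ j, ∑ k ∈ K j with e j k = 0, c j k) = 1 :=
    Finset.prod_eq_one fun j _ => by simp [K, c, e, Finset.sum_filter]
  have huk1 : (∑ p ∈ Fintype.piFinset K, (∏ j, c j (p j)) * m (∑ j, e j (p j) * lam j)) =
      ∑ i : F, ((‖b i‖ / 2 : ℝ) : ℂ) := by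
    symm
    refine Finset.sum_of_injOn (fun i : F => (Pi.single i (-1) : F → ℤ)) ?_ ?_ ?_ ?_
    · intro i _ j _ hij
      by_contra hne
      have := congrFun hij i
      simp [Pi.single_eq_of_ne hne] at this
    · intro i _
      simp only [Finset.mem_coe, Fintype.mem_piFinset]
      intro j
      by_cases hij : j = i
      · subst hij
        simp [K]
      · simp [K, Pi.single_eq_of_ne hij]
    -- By independence, a frequency of the product is the negative of an exponent only when one
    -- factor has index -1 and all others have index 0.
    · intro p _ hp
      rw [hm0, mul_zero]
      rintro ⟨i, hi⟩
      obtain ⟨hiF, hn⟩ := eq_single_of_sum_mul_eq hlin (F := F) (n := fun j => -p j) (i := i) (by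
        rw [hi]
        simp [e])
      refine hp ⟨⟨i, hiF⟩, by simp, ?_⟩
      have : p = -(fun j => -p j) := by
        ext j
        simp
      rw [this, hn, ← Pi.single_neg]
    · intro i _
      have h1 : ∑ j : F, (e j ((Pi.single i (-1) : F → ℤ) j) : ℝ) * lam j = -lam i := by
        rw [Finset.sum_eq_single i]
        · simp [e]
        · intro j _ hj
          simp [e, Pi.single_eq_of_ne hj]
        · simp
      have h2 : ∏ j : F, c j ((Pi.single i (-1) : F → ℤ) j) = w i / 2 := by
        rw [Finset.prod_eq_single i]
        · simp [c]
        · intro j _ hj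
          simp [c, Pi.single_eq_of_ne hj]
        · simp
      rw [h1, h2, hmb]
      push_cast
      rw [← hwb]
      ring
  rw [hk1] at hk
  rw [huk1] at huk
  have hcont : Continuous fun t : ℝ =>
      (C : ℂ) * ∏ j : F, ∑ k ∈ K j, c j k * Complex.exp (e j k * (lam j * t * Complex.I)) := by
    fun_prop
  have := huk.norm_le_re hcont (hk.const_mul C) fun t => by
    simp only [hP]
    rw [← Complex.ofReal_prod, ← Complex.ofReal_mul, Complex.ofReal_re]
    have h0 : 0 ≤ ∏ j : F, (1 + ((starRingEnd ℂ) (w j) * Complex.exp (lam j * t * Complex.I)).re) :=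
      Finset.prod_nonneg fun j _ => hP0 j t
    rw [norm_mul, Complex.norm_real, Real.norm_of_nonneg h0]
    exact mul_le_mul_of_nonneg_right (hC t) h0
  rw [← Complex.ofReal_sum, Complex.norm_real, mul_one, Complex.ofReal_re] at this
  have h := (le_abs_self _).trans this
  rw [← Finset.sum_div, Finset.sum_coe_sort F fun i => ‖b i‖] at h
  linarith

/-! ### Bohr's uniqueness theorem -/

open MeasureTheory in
/-- `L²` bound for the correlation of a periodic function with a bounded function on a period, in
terms of the largest Fourier coefficient of the periodic function. -/
theorem integral_norm_sq_correlation_le {P : ℝ} (hP : 0 < P) {U W : ℝ → ℂ} (hU : Measurable U)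
    (hW : Measurable W) {C D : ℝ} (hUC : ∀ t, ‖U t‖ ≤ C) (hWD : ∀ t, ‖W t‖ ≤ D)
    (hper : Function.Periodic U P) {M : ℝ}
    (hM : ∀ x : ℝ, ‖∫ t in 0..P, Complex.exp (x * t * Complex.I) * U t‖ ≤ M) :
    ∫ x in 0..P, ‖∫ t in 0..P, U (t + x) * (starRingEnd ℂ) (W t)‖ ^ 2 ≤
      M ^ 2 * ∫ t in 0..P, ‖W t‖ ^ 2 := by
  have hC0 : 0 ≤ C := (norm_nonneg _).trans (hUC 0)
  have hD0 : 0 ≤ D := (norm_nonneg _).trans (hWD 0)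
  set G : ℝ → ℂ := fun x => ∫ t in 0..P, U (t + x) * (starRingEnd ℂ) (W t) with hG
  have hker : ∀ x t, ‖U (t + x) * (starRingEnd ℂ) (W t)‖ ≤ C * D := fun x t => by
    rw [norm_mul, RCLike.norm_conj]
    exact mul_le_mul (hUC _) (hWD _) (norm_nonneg _) hC0
  have hGm : StronglyMeasurable G := by
    have : Measurable fun p : ℝ × ℝ => U (p.2 + p.1) * (starRingEnd ℂ) (W p.2) :=
      (hU.comp (measurable_snd.add measurable_fst)).mul
        (Complex.continuous_conj.measurable.comp (hW.comp measurable_snd))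
    simp only [hG, intervalIntegral.integral_of_le hP.le]
    exact this.stronglyMeasurable.integral_prod_right
  have hGb : ∀ x, ‖G x‖ ≤ C * D * P := fun x => by
    have := intervalIntegral.norm_integral_le_of_norm_le_const (a := 0) (b := P)
      fun t _ => hker x t
    rwa [sub_zero, abs_of_pos hP] at this
  have hGL : MemLp G 2 (volume.restrict (Ioc 0 P)) :=
    MemLp.of_bound hGm.aestronglyMeasurable (C * D * P) (Eventually.of_forall hGb)
  have hWL : MemLp W 2 (volume.restrict (Ioc 0 P)) :=
    MemLp.of_bound hW.aestronglyMeasurable D (Eventually.of_forall hWD)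
  -- The n-th Fourier coefficient of the correlation is ∫ E U times the conjugate of that of W.
  -- Parseval for both G and W then gives the bound.
  have hcoef : ∀ n : ℤ, ‖fourierCoeffOn hP G n‖ ^ 2 ≤ M ^ 2 * ‖fourierCoeffOn hP W n‖ ^ 2 := by
    intro n
    set x₀ : ℝ := -(2 * Real.pi * n / P) with hx₀
    set E : ℝ → ℂ := fun t => Complex.exp (x₀ * t * Complex.I) with hE
    have hEm : Measurable E := (continuous_cexp_mul_I x₀).measurable
    have hE1 : ∀ t, ‖E t‖ = 1 := fun t => by
      simp only [hE, ← Complex.ofReal_mul, Complex.norm_exp_ofReal_mul_I]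
    have hEadd : ∀ s t, E (s + t) = E s * E t := fun s t => by
      simp only [hE, ← Complex.exp_add]
      congr 1
      push_cast
      ring
    have hEneg : ∀ t, E (-t) = (starRingEnd ℂ) (E t) := fun t => by
      simp only [hE, ← Complex.exp_conj]
      congr 1
      simp
    have hEP : Function.Periodic E P := fun t => by
      have : E P = 1 := by
        simp only [hE, hx₀]
        rw [Complex.exp_eq_one_iff]
        refine ⟨-n, ?_⟩
        have : (P : ℂ) ≠ 0 := by exact_mod_cast hP.ne'
        push_cast
        field_simp
      rw [hEadd, this, mul_one]
    have hf : ∀ f : ℝ → ℂ, fourierCoeffOn hP f n = (1 / P) • ∫ t in 0..P, E t * f t := fun f => by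
      rw [fourierCoeffOn_eq_integral]
      simp only [sub_zero, fourier_coe_apply, smul_eq_mul]
      congr 1
      refine intervalIntegral.integral_congr fun t _ => ?_
      simp only [hE, hx₀]
      congr 2
      push_cast
      ring
    have hswap : ∫ x in 0..P, E x * G x =
        (∫ t in 0..P, E t * U t) * (starRingEnd ℂ) (∫ t in 0..P, E t * W t) := by
      have h1 : ∀ x, E x * G x = ∫ t in 0..P, E x * (U (t + x) * (starRingEnd ℂ) (W t)) := fun x => by
        rw [intervalIntegral.integral_const_mul]
      simp only [h1]
      rw [intervalIntegral_intervalIntegral_swap]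
      · have h2 : ∀ t, ∫ x in 0..P, E x * (U (t + x) * (starRingEnd ℂ) (W t)) =
            (∫ t in 0..P, E t * U t) * (starRingEnd ℂ) (E t * W t) := by
          intro t
          have h3 : ∀ x, E x * (U (t + x) * (starRingEnd ℂ) (W t)) =
              (starRingEnd ℂ) (E t * W t) * (fun y => E y * U y) (t + x) := fun x => by
            have : E x = (starRingEnd ℂ) (E t) * E (t + x) := by
              rw [← hEneg, ← hEadd]
              congr 1
              ring
            rw [this, map_mul]
            ring
          simp only [h3]
          rw [intervalIntegral.integral_const_mul,
            intervalIntegral.integral_comp_add_left (fun y => E y * U y) t, mul_comm]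
          congr 1
          -- Periodicity of E · U moves the integral over [t, t + P] back to [0, P].
          have := (hEP.mul hper).intervalIntegral_add_eq t 0
          rw [zero_add] at this
          rw [add_zero]
          exact this
        simp only [h2]
        rw [intervalIntegral.integral_const_mul]
        congr 1
        simp only [intervalIntegral.integral_of_le hP.le]
        exact integral_conj
      · unfold IntegrableOn
        rw [Measure.volume_eq_prod, ← Measure.prod_restrict, uIoc_of_le hP.le]
        refine Integrable.of_bound (C := C * D) (Measurable.aestronglyMeasurable ?_)
          (Eventually.of_forall fun p => ?_)
        · exact (hEm.comp measurable_fst).mul ((hU.comp (measurable_snd.add measurable_fst)).mul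
            (Complex.continuous_conj.measurable.comp (hW.comp measurable_snd)))
        · simp only [Function.uncurry, norm_mul (E _), hE1, one_mul]
          exact hker _ _
    rw [hf, hf, hswap, norm_smul, norm_smul, norm_mul, RCLike.norm_conj, mul_pow, mul_pow, mul_pow,
      mul_left_comm]
    refine mul_le_mul_of_nonneg_right ?_ (by positivity)
    exact pow_le_pow_left₀ (norm_nonneg _) (hM x₀) 2
  have h1 := hasSum_sq_fourierCoeffOn hP hGL
  have h2 := (hasSum_sq_fourierCoeffOn hP hWL).mul_left (M ^ 2)
  have h3 := hasSum_le hcoef h1 h2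
  rw [sub_zero, smul_eq_mul, smul_eq_mul, mul_left_comm] at h3
  exact le_of_mul_le_mul_left h3 (by positivity)

/-- Mean zero makes the integral small over one long window [-T, T]; a translation number carries
that window to within l of any prescribed one of the same length. The mismatch at the two ends costs
at most 2lC, which is below εT by the choice of T. -/
theorem IsAP.exists_forall_norm_integral_le {v : ℝ → ℂ} (hv : IsAP v) (h0 : HasMean v 0) {ε : ℝ}
    (hε : 0 < ε) : ∃ A : ℝ, 0 < A ∧ ∀ c, ‖∫ t in c..(c + A), v t‖ ≤ ε * A := by
  obtain ⟨C, hC, hCv⟩ := hv.exists_bound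
  obtain ⟨l, hl, h⟩ := hv.2 (ε / 4) (by linarith)
  have hT := (Metric.tendsto_nhds.1 h0 (ε / 4) (by linarith)).and
    (eventually_gt_atTop (max 0 (2 * l * C / ε)))
  obtain ⟨T, hT1, hT2⟩ := hT.exists
  have hT0 : 0 < T := (le_max_left _ _).trans_lt hT2
  have hTl : 2 * l * C < T * ε := by
    have := (le_max_right _ _).trans_lt hT2
    rwa [div_lt_iff₀ hε] at this
  have hii : ∀ a b, IntervalIntegrable v MeasureTheory.volume a b :=
    fun a b => hv.1.intervalIntegrable a b
  refine ⟨2 * T, by positivity, fun c => ?_⟩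
  rw [dist_zero_right, norm_smul, Real.norm_of_nonneg (by positivity), inv_mul_lt_iff₀ (by positivity)]
    at hT1
  obtain ⟨τ, hτ, h'⟩ := h (c + T)
  have e1 : ∫ t in (-T)..T, v (t + τ) = ∫ t in (-T + τ)..(T + τ), v t :=
    intervalIntegral.integral_comp_add_right v τ
  have e2 : ‖(∫ t in (-T)..T, v (t + τ)) - ∫ t in (-T)..T, v t‖ ≤ ε / 4 * (2 * T) := by
    have hs : Continuous fun t => v (t + τ) := hv.1.comp (by fun_prop)
    rw [← intervalIntegral.integral_sub (hs.intervalIntegrable _ _) (hii _ _)]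
    have := intervalIntegral.norm_integral_le_of_norm_le_const (a := -T) (b := T)
      fun t _ => h' t
    rwa [abs_of_pos (by linarith), show T - -T = 2 * T by ring] at this
  have e3 : ∫ t in c..(c + 2 * T), v t = (∫ t in c..(-T + τ), v t) +
      (∫ t in (-T + τ)..(T + τ), v t) - ∫ t in (c + 2 * T)..(T + τ), v t := by
    linear_combination
      intervalIntegral.integral_add_adjacent_intervals (hii c (c + 2 * T)) (hii _ (T + τ)) -
      intervalIntegral.integral_add_adjacent_intervals (hii c (-T + τ)) (hii _ (T + τ))
  have b1 : ‖∫ t in c..(-T + τ), v t‖ ≤ C * l := by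
    refine (intervalIntegral.norm_integral_le_of_norm_le_const fun t _ => hCv t).trans ?_
    rw [abs_of_pos (by linarith [hτ.1])]
    exact mul_le_mul_of_nonneg_left (by linarith [hτ.2]) hC.le
  have b2 : ‖∫ t in (c + 2 * T)..(T + τ), v t‖ ≤ C * l := by
    refine (intervalIntegral.norm_integral_le_of_norm_le_const fun t _ => hCv t).trans ?_
    rw [abs_of_pos (by linarith [hτ.1])]
    exact mul_le_mul_of_nonneg_left (by linarith [hτ.2]) hC.le
  rw [e3, ← e1]
  have n1 := norm_sub_le ((∫ t in c..(-T + τ), v t) + ∫ t in (-T)..T, v (t + τ))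
    (∫ t in (c + 2 * T)..(T + τ), v t)
  have n2 := norm_add_le (∫ t in c..(-T + τ), v t) (∫ t in (-T)..T, v (t + τ))
  have n3 := norm_add_le ((∫ t in (-T)..T, v (t + τ)) - ∫ t in (-T)..T, v t) (∫ t in (-T)..T, v t)
  rw [sub_add_cancel] at n3
  nlinarith

theorem norm_integral_le_of_blocks {v : ℝ → ℂ} (hv : Continuous v) {C : ℝ} (hC : ∀ t, ‖v t‖ ≤ C)
    {ε A : ℝ} (hε : 0 ≤ ε) (hA : 0 < A) (h : ∀ c, ‖∫ t in c..(c + A), v t‖ ≤ ε * A) {T : ℝ}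
    (hT : 0 ≤ T) (c : ℝ) : ‖∫ t in c..(c + T), v t‖ ≤ ε * T + C * A := by
  have hii : ∀ a b, IntervalIntegrable v MeasureTheory.volume a b :=
    fun a b => hv.intervalIntegrable a b
  have hC0 : 0 ≤ C := (norm_nonneg _).trans (hC 0)
  have hn : ∀ n : ℕ, ‖∫ t in c..(c + n * A), v t‖ ≤ ε * (n * A) := by
    intro n
    induction n with
    | zero => simp
    | succ n ih =>
      rw [← intervalIntegral.integral_add_adjacent_intervals (hii c (c + n * A)) (hii _ _)]
      refine (norm_add_le _ _).trans ?_
      have := h (c + n * A)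
      rw [show c + n * A + A = c + (n + 1 : ℕ) * A by push_cast; ring] at this
      push_cast at this ⊢
      linarith
  set n := ⌊T / A⌋₊ with hnd
  have h1 : n * A ≤ T := by
    have := Nat.floor_le (div_nonneg hT hA.le)
    rwa [le_div_iff₀ hA] at this
  have h2 : T < (n + 1) * A := by
    have := Nat.lt_floor_add_one (T / A)
    rwa [div_lt_iff₀ hA] at this
  rw [← intervalIntegral.integral_add_adjacent_intervals (hii c (c + n * A)) (hii _ _)]
  refine (norm_add_le _ _).trans ?_
  have b1 : ‖∫ t in (c + n * A)..(c + T), v t‖ ≤ C * A := by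
    refine (intervalIntegral.norm_integral_le_of_norm_le_const fun t _ => hC t).trans ?_
    rw [abs_of_nonneg (by linarith)]
    exact mul_le_mul_of_nonneg_left (by linarith) hC0
  have := hn n
  have := mul_le_mul_of_nonneg_left h1 hε
  linarith

theorem norm_cexp_mul_I (x t : ℝ) : ‖Complex.exp (x * t * Complex.I)‖ = 1 := by
  rw [← Complex.ofReal_mul, Complex.norm_exp_ofReal_mul_I]

/-- Small finite Fourier integrals near a frequency with vanishing coefficient. -/
theorem IsAP.exists_near_frequency {u : ℝ → ℂ} (hu : IsAP u) {x₀ : ℝ}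
    (h0 : HasMean (fun t => u t * Complex.exp (x₀ * t * Complex.I)) 0) {ε : ℝ} (hε : 0 < ε) :
    ∃ T₀ : ℝ, ∃ δ : ℝ, 0 < δ ∧ ∀ x, |x - x₀| < δ → ∀ T, T₀ ≤ T → ∀ c,
      ‖∫ t in c..(c + T), u t * Complex.exp (x * t * Complex.I)‖ ≤ ε * T := by
  obtain ⟨C, hC, hCu⟩ := hu.exists_bound
  obtain ⟨A, hA, h⟩ := (hu.mul (IsAP.exp x₀)).exists_forall_norm_integral_le h0
    (ε := ε / 4) (by linarith)
  -- The threshold T₀ makes the incomplete block cost CA ≤ εT/2; the radius δ makes the phase drift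
  -- over one block cost at most Cδ A = ε/4 pointwise.
  refine ⟨2 * C * A / ε, ε / (4 * C * A), by positivity, fun x hx T hT c => ?_⟩
  have hblock : ∀ c, ‖∫ t in c..(c + A), u t * Complex.exp (x * t * Complex.I)‖ ≤ ε / 2 * A := by
    intro c
    -- The factor k freezes the phase difference at the left end of the block.
    set k : ℂ := Complex.exp ((x - x₀ : ℝ) * c * Complex.I) with hk
    have e : ∀ t : ℝ, u t * Complex.exp (x * t * Complex.I) =
        k * (u t * Complex.exp (x₀ * t * Complex.I)) + k * (u t * Complex.exp (x₀ * t * Complex.I)) *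
          (Complex.exp ((x - x₀ : ℝ) * (t - c : ℝ) * Complex.I) - 1) := by
      intro t
      have : Complex.exp (x * t * Complex.I) = k * Complex.exp (x₀ * t * Complex.I) *
          Complex.exp ((x - x₀ : ℝ) * (t - c : ℝ) * Complex.I) := by
        rw [hk, ← Complex.exp_add, ← Complex.exp_add]
        congr 1
        push_cast
        ring
      rw [this]
      ring
    have hk1 : ‖k‖ = 1 := norm_cexp_mul_I _ _
    have hc : Continuous u := hu.1
    simp only [e]
    rw [intervalIntegral.integral_add (Continuous.intervalIntegrable (by fun_prop) _ _)
      (Continuous.intervalIntegrable (by fun_prop) _ _), intervalIntegral.integral_const_mul]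
    refine (norm_add_le _ _).trans ?_
    rw [norm_mul, hk1, one_mul]
    have h1 := h c
    have h2 : ‖∫ t in c..(c + A), k * (u t * Complex.exp (x₀ * t * Complex.I)) *
        (Complex.exp ((x - x₀ : ℝ) * (t - c : ℝ) * Complex.I) - 1)‖ ≤ ε / 4 * |c + A - c| := by
      refine intervalIntegral.norm_integral_le_of_norm_le_const fun t ht => ?_
      rw [uIoc_of_le (by linarith)] at ht
      rw [norm_mul, norm_mul, norm_mul, hk1, norm_cexp_mul_I, one_mul, mul_one]
      have h3 : ‖Complex.exp ((x - x₀ : ℝ) * (t - c : ℝ) * Complex.I) - 1‖ ≤ |x - x₀| * A := by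
        rw [← Complex.ofReal_mul, mul_comm _ Complex.I]
        refine (Real.norm_exp_I_mul_ofReal_sub_one_le).trans ?_
        rw [Real.norm_eq_abs, abs_mul]
        refine mul_le_mul_of_nonneg_left ?_ (abs_nonneg _)
        rw [abs_of_pos (by linarith [ht.1])]
        linarith [ht.2]
      calc ‖u t‖ * ‖Complex.exp ((x - x₀ : ℝ) * (t - c : ℝ) * Complex.I) - 1‖
          ≤ C * (ε / (4 * C * A) * A) := by
            refine mul_le_mul (hCu t) (h3.trans ?_) (norm_nonneg _) hC.le
            exact mul_le_mul_of_nonneg_right hx.le hA.le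
        _ = ε / 4 := by field_simp
    rw [add_sub_cancel_left, abs_of_pos hA] at h2
    linarith
  have hT0 : 0 ≤ T := le_trans (by positivity) hT
  have := norm_integral_le_of_blocks (hu.1.mul (continuous_cexp_mul_I x)) (C := C)
    (fun t => by rw [Pi.mul_apply, norm_mul, norm_cexp_mul_I, mul_one]; exact hCu t)
    (by linarith) hA hblock hT0 c
  rw [div_le_iff₀ hε] at hT
  refine this.trans ?_
  linarith

/-- Finite Fourier integrals are uniformly small for large frequencies. -/
theorem IsAP.exists_large_frequency {u : ℝ → ℂ} (hu : IsAP u) {ε : ℝ} (hε : 0 < ε) :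
    ∃ Λ : ℝ, ∀ x, Λ < |x| → ∀ T, 1 ≤ T → ∀ c,
      ‖∫ t in c..(c + T), u t * Complex.exp (x * t * Complex.I)‖ ≤ ε * T := by
  obtain ⟨C, hC, hCu⟩ := hu.exists_bound
  obtain ⟨δ, hδ, huc⟩ := Metric.uniformContinuous_iff.1 hu.uniformContinuous ε hε
  refine ⟨max (Real.pi / δ) (2 * Real.pi * C / ε), fun x hx T hT c => ?_⟩
  have hx0 : 0 < |x| := lt_of_le_of_lt (by have := Real.pi_pos; positivity)
    ((le_max_left _ _).trans_lt hx)
  have hxne : x ≠ 0 := abs_pos.1 hx0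
  have hx1 := (le_max_left _ _).trans_lt hx
  have hx2 := (le_max_right _ _).trans_lt hx
  rw [div_lt_iff₀ hδ] at hx1
  rw [div_lt_iff₀ hε] at hx2
  -- A shift by half a period reverses the sign of the exponential, so twice the integral is an
  -- integral of u(t) - u(t + h) against it plus two end pieces. The bounds on |x| make |h| < δ and
  -- the ends cost less than ε ≤ εT.
  set h : ℝ := Real.pi / x with hh
  have habs : |h| = Real.pi / |x| := by rw [hh, abs_div, abs_of_pos Real.pi_pos]
  have hhδ : |h| < δ := by rw [habs, div_lt_iff₀ hx0]; linarith
  have hhC : 2 * |h| * C < ε := by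
    rw [habs, show 2 * (Real.pi / |x|) * C = 2 * Real.pi * C / |x| by ring, div_lt_iff₀ hx0]
    linarith
  set v : ℝ → ℂ := fun t => u t * Complex.exp (x * t * Complex.I) with hv
  have hvc : Continuous v := hu.1.mul (continuous_cexp_mul_I x)
  have hvb : ∀ t, ‖v t‖ ≤ C := fun t => by
    rw [hv, norm_mul, norm_cexp_mul_I, mul_one]; exact hCu t
  have hii : ∀ a b, IntervalIntegrable v MeasureTheory.volume a b :=
    fun a b => hvc.intervalIntegrable a b
  have hshift : ∀ t, v (t + h) = -(u (t + h) * Complex.exp (x * t * Complex.I)) := by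
    intro t
    have : Complex.exp (x * (t + h : ℝ) * Complex.I) = -Complex.exp (x * t * Complex.I) := by
      have hxc : (x : ℂ) ≠ 0 := by exact_mod_cast hxne
      rw [show (x : ℂ) * (t + h : ℝ) * Complex.I = x * t * Complex.I + Real.pi * Complex.I by
        rw [hh]; push_cast; field_simp, Complex.exp_add, Complex.exp_pi_mul_I]
      ring
    simp only [hv, this]
    ring
  have e1 : ∫ t in c..(c + T), v (t + h) = ∫ t in (c + h)..(c + T + h), v t :=
    intervalIntegral.integral_comp_add_right v h
  have e2 : ∫ t in c..(c + T), v t = (∫ t in c..(c + h), v t) + (∫ t in c..(c + T), v (t + h)) -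
      ∫ t in (c + T)..(c + T + h), v t := by
    rw [e1]
    linear_combination
      intervalIntegral.integral_add_adjacent_intervals (hii c (c + T)) (hii _ (c + T + h)) -
      intervalIntegral.integral_add_adjacent_intervals (hii c (c + h)) (hii _ (c + T + h))
  have e3 : ‖(∫ t in c..(c + T), v t) + ∫ t in c..(c + T), v (t + h)‖ ≤ ε * T := by
    have hs : Continuous fun t => v (t + h) := hvc.comp (by fun_prop)
    rw [← intervalIntegral.integral_add (hii _ _) (hs.intervalIntegrable _ _)]
    refine (intervalIntegral.norm_integral_le_of_norm_le_const (C := ε) fun t _ => ?_).trans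
      (by rw [add_sub_cancel_left, abs_of_pos (by linarith)])
    rw [hshift, show v t + -(u (t + h) * Complex.exp (x * t * Complex.I)) =
      (u t - u (t + h)) * Complex.exp (x * t * Complex.I) by simp only [hv]; ring, norm_mul,
      norm_cexp_mul_I, mul_one, ← dist_eq_norm]
    exact (huc (by rw [Real.dist_eq, sub_add_cancel_left, abs_neg]; exact hhδ)).le
  have b : ∀ c, ‖∫ t in c..(c + h), v t‖ ≤ C * |h| := fun c => by
    refine (intervalIntegral.norm_integral_le_of_norm_le_const fun t _ => hvb t).trans ?_
    rw [add_sub_cancel_left]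
  set I := ∫ t in c..(c + T), v t
  set J := ∫ t in c..(c + T), v (t + h)
  have e4 : (2 : ℂ) * I = (I + J) + (∫ t in c..(c + h), v t) - ∫ t in (c + T)..(c + T + h), v t := by
    linear_combination e2
  have n1 : ‖(2 : ℂ) * I‖ = 2 * ‖I‖ := by simp
  have n2 := norm_sub_le ((I + J) + ∫ t in c..(c + h), v t) (∫ t in (c + T)..(c + T + h), v t)
  have n3 := norm_add_le (I + J) (∫ t in c..(c + h), v t)
  rw [← e4, n1] at n2
  have := b c
  have := b (c + T)
  nlinarith

/-- If all Fourier coefficients vanish, the finite Fourier integrals are uniformly small. -/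
theorem IsAP.exists_uniform {u : ℝ → ℂ} (hu : IsAP u)
    (h0 : ∀ x : ℝ, HasMean (fun t => u t * Complex.exp (x * t * Complex.I)) 0) {ε : ℝ} (hε : 0 < ε) :
    ∃ T₀ : ℝ, ∀ T, T₀ ≤ T → ∀ x c : ℝ,
      ‖∫ t in c..(c + T), u t * Complex.exp (x * t * Complex.I)‖ ≤ ε * T := by
  obtain ⟨Λ, hΛ⟩ := hu.exists_large_frequency hε
  -- Frequencies in [-Λ, Λ] are handled by compactness, since each has a neighbourhood with its own
  -- threshold T₀.
  have hK : ∃ T₀ : ℝ, ∀ x ∈ Icc (-Λ) Λ, ∀ T, T₀ ≤ T → ∀ c : ℝ,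
      ‖∫ t in c..(c + T), u t * Complex.exp (x * t * Complex.I)‖ ≤ ε * T := by
    refine (isCompact_Icc (a := -Λ) (b := Λ)).induction_on (p := fun s => ∃ T₀ : ℝ, ∀ x ∈ s, ∀ T,
      T₀ ≤ T → ∀ c : ℝ, ‖∫ t in c..(c + T), u t * Complex.exp (x * t * Complex.I)‖ ≤ ε * T)
      ⟨0, by simp⟩ ?_ ?_ ?_
    · rintro s t hst ⟨T₀, h⟩
      exact ⟨T₀, fun x hx => h x (hst hx)⟩
    · rintro s t ⟨T₀, h⟩ ⟨T₁, h'⟩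
      refine ⟨max T₀ T₁, fun x hx T hT => ?_⟩
      rcases hx with hx | hx
      · exact h x hx T ((le_max_left _ _).trans hT)
      · exact h' x hx T ((le_max_right _ _).trans hT)
    · intro x₀ _
      obtain ⟨T₀, δ, hδ, h⟩ := hu.exists_near_frequency (h0 x₀) hε
      refine ⟨Metric.ball x₀ δ, mem_nhdsWithin_of_mem_nhds (Metric.ball_mem_nhds _ hδ), T₀,
        fun x hx => h x ?_⟩
      rwa [Metric.mem_ball, Real.dist_eq] at hx
  obtain ⟨T₀, hT₀⟩ := hK
  refine ⟨max T₀ 1, fun T hT x c => ?_⟩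
  by_cases hx : Λ < |x|
  · exact hΛ x hx T ((le_max_right _ _).trans hT) c
  · exact hT₀ x (abs_le.1 (not_lt.1 hx)) T ((le_max_left _ _).trans hT) c

theorem le_integral_of_blocks {q : ℝ → ℝ} (hq0 : ∀ t, 0 ≤ q t) {T A κ : ℝ} (hA : 0 < A) (hκ : 0 ≤ κ)
    (hT : 0 ≤ T) (hq : Continuous q)
    (h : ∀ c, 0 ≤ c → c + A ≤ T → κ ≤ ∫ t in c..(c + A), q t) :
    κ * (T / A - 1) ≤ ∫ t in 0..T, q t := by
  have hii : ∀ a b, IntervalIntegrable q MeasureTheory.volume a b :=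
    fun a b => hq.intervalIntegrable a b
  have hn : ∀ n : ℕ, n * A ≤ T → κ * n ≤ ∫ t in 0..(n * A), q t := by
    intro n
    induction n with
    | zero => simp
    | succ n ih =>
      intro hnT
      have e : ((n + 1 : ℕ) : ℝ) * A = n * A + A := by push_cast; ring
      rw [e] at hnT ⊢
      rw [← intervalIntegral.integral_add_adjacent_intervals (hii 0 (n * A)) (hii _ _)]
      have h1 := ih (by linarith)
      have h2 := h (n * A) (by positivity) hnT
      push_cast
      linarith
  set n := ⌊T / A⌋₊ with hnd
  have h1 : n * A ≤ T := by
    have := Nat.floor_le (div_nonneg hT hA.le)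
    rwa [le_div_iff₀ hA] at this
  have h2 : T / A < n + 1 := Nat.lt_floor_add_one (T / A)
  rw [← intervalIntegral.integral_add_adjacent_intervals (hii 0 (n * A)) (hii _ _)]
  have h3 : 0 ≤ ∫ t in (n * A)..T, q t :=
    intervalIntegral.integral_nonneg h1 fun t _ => hq0 t
  have h4 := hn n h1
  have h5 : κ * (T / A - 1) ≤ κ * n := mul_le_mul_of_nonneg_left (by linarith) hκ
  linarith

theorem le_integral_of_subinterval {q : ℝ → ℝ} (hq0 : ∀ t, 0 ≤ q t) (hq : Continuous q)
    {a b p δ m : ℝ} (hδ : 0 ≤ δ) (hap : a ≤ p - δ) (hpb : p + δ ≤ b)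
    (hm : ∀ t ∈ Icc (p - δ) (p + δ), m ≤ q t) : 2 * δ * m ≤ ∫ t in a..b, q t := by
  have hii : ∀ a b, IntervalIntegrable q MeasureTheory.volume a b :=
    fun a b => hq.intervalIntegrable a b
  have h1 : ∫ t in (p - δ)..(p + δ), q t ≤ ∫ t in a..b, q t :=
    intervalIntegral.integral_mono_interval hap (by linarith) hpb
      (Eventually.of_forall fun t => hq0 t) (hii _ _)
  have h2 := intervalIntegral.integral_mono_on (show p - δ ≤ p + δ by linarith)
    (intervalIntegrable_const (c := m)) (hii _ _) hm
  rw [intervalIntegral.integral_const, smul_eq_mul] at h2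
  linarith

/-- Every interval of some fixed length contains a shorter one, of fixed length, made of translation
numbers. -/
theorem IsAP.exists_interval {u : ℝ → ℂ} (hu : IsAP u) {ε : ℝ} (hε : 0 < ε) :
    ∃ A δ : ℝ, 0 < A ∧ 0 < δ ∧ ∀ c, ∃ p, c ≤ p - δ ∧ p + δ ≤ c + A ∧
      ∀ τ ∈ Icc (p - δ) (p + δ), ∀ t, ‖u (t + τ) - u t‖ ≤ ε := by
  obtain ⟨l, hl, h⟩ := hu.2 (ε / 2) (half_pos hε)
  obtain ⟨δ, hδ, huc⟩ := Metric.uniformContinuous_iff.1 hu.uniformContinuous (ε / 2) (half_pos hε)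
  refine ⟨l + δ, δ / 2, by positivity, by positivity, fun c => ?_⟩
  obtain ⟨p, hp, h'⟩ := h (c + δ / 2)
  refine ⟨p, by linarith [hp.1], by linarith [hp.2], fun τ hτ t => ?_⟩
  have h1 := h' t
  have h2 := huc (a := t + τ) (b := t + p) (by
    rw [Real.dist_eq, add_sub_add_left_eq_sub]
    exact abs_lt.2 ⟨by linarith [hτ.1], by linarith [hτ.2]⟩)
  rw [dist_eq_norm] at h2
  have := norm_add_le (u (t + τ) - u (t + p)) (u (t + p) - u t)
  rw [sub_add_sub_cancel] at this
  linarith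

/-- Every window of length A contains an interval of length 2δ on which |u| ≥ |u(t₁)|/2, so the
energy grows linearly. For T ≥ 2A the incomplete block is absorbed by halving the constant. -/
theorem IsAP.exists_le_integral_norm_sq {u : ℝ → ℂ} (hu : IsAP u) {t₁ : ℝ} (h1 : u t₁ ≠ 0) :
    ∃ κ T₀ : ℝ, 0 < κ ∧ ∀ T, T₀ ≤ T → κ * T ≤ ∫ t in 0..T, ‖u t‖ ^ 2 := by
  have hd : 0 < ‖u t₁‖ := norm_pos_iff.2 h1
  obtain ⟨A, δ, hA, hδ, h⟩ := hu.exists_interval (half_pos hd)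
  have hc : Continuous fun t => ‖u t‖ ^ 2 := hu.1.norm.pow 2
  refine ⟨2 * δ * (‖u t₁‖ / 2) ^ 2 / (2 * A), 2 * A, by positivity, fun T hT => ?_⟩
  have hκ : 0 ≤ 2 * δ * (‖u t₁‖ / 2) ^ 2 := by positivity
  refine le_trans ?_ (le_integral_of_blocks (fun t => by positivity) hA hκ
    (by linarith) hc fun c _ _ => ?_)
  · rw [div_mul_eq_mul_div, mul_div_assoc]
    refine mul_le_mul_of_nonneg_left ?_ hκ
    rw [show T / (2 * A) = T / A - T / (2 * A) by field_simp; ring]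
    have : 1 ≤ T / (2 * A) := by rwa [le_div_iff₀ (by positivity), one_mul]
    linarith
  · obtain ⟨p, hp1, hp2, hp⟩ := h (c - t₁)
    refine le_integral_of_subinterval (p := t₁ + p) (fun t => by positivity) hc hδ.le (by linarith)
      (by linarith) fun t ht => ?_
    have h2 := hp (t - t₁) ⟨by linarith [ht.1], by linarith [ht.2]⟩ t₁
    rw [add_sub_cancel] at h2
    have h3 := norm_sub_norm_le (u t₁) (u t)
    rw [norm_sub_rev] at h3
    exact pow_le_pow_left₀ (by positivity) (by linarith) 2

open MeasureTheory in
/-- Bohr's uniqueness theorem: an almost periodic function with vanishing Fourier coefficients is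
zero. -/
theorem IsAP.eq_zero {u : ℝ → ℂ} (hu : IsAP u)
    (h0 : ∀ x : ℝ, HasMean (fun t => u t * Complex.exp (x * t * Complex.I)) 0) (t₁ : ℝ) :
    u t₁ = 0 := by
  -- The autocorrelation G(x) = ∫₀ᵀ u(t + x) conj(u(t)) dt is at least κT/2 in modulus at
  -- translation numbers x, which fill a positive proportion of [0, T]; so ∫|G|² ≥ ρT³. Parseval
  -- with uniformly small Fourier integrals bounds the same quantity by ρT³/2.
  by_contra hne
  obtain ⟨C, hC, hCu⟩ := hu.exists_bound
  obtain ⟨κ, T₁, hκ, hlow⟩ := hu.exists_le_integral_norm_sq hne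
  obtain ⟨A, δ, hA, hδ, hint⟩ := hu.exists_interval (ε := κ / (2 * C)) (by positivity)
  set ρ : ℝ := δ * κ ^ 2 / (4 * A) with hρ
  have hρ0 : 0 < ρ := by positivity
  -- Chosen so that M² · C² · 2T = ρT³/2 with M = √(ρ/(16C²)) · 2T.
  obtain ⟨T₀, hunif⟩ := hu.exists_uniform h0 (ε := Real.sqrt (ρ / (16 * C ^ 2))) (by positivity)
  set T : ℝ := max (max T₀ T₁) (max (2 * A) 1) with hTdef
  have hT0 : T₀ ≤ T := (le_max_left _ _).trans (le_max_left _ _)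
  have hT1 : T₁ ≤ T := (le_max_right _ _).trans (le_max_left _ _)
  have hTA : 2 * A ≤ T := (le_max_left _ _).trans (le_max_right _ _)
  have hT1' : 1 ≤ T := (le_max_right _ _).trans (le_max_right _ _)
  have hTpos : 0 < T := by linarith
  have hP : 0 < 2 * T := by positivity
  -- Period 2T with W cut off at T prevents wrap-around: t + x < 2T whenever t, x < T.
  set U : ℝ → ℂ := fun t => u (2 * T * Int.fract (t / (2 * T))) with hUdef
  set W : ℝ → ℂ := (Iio T).indicator u with hWdef
  have hUeq : ∀ t, 0 ≤ t → t < 2 * T → U t = u t := fun t ht0 ht => by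
    simp only [hUdef]
    rw [Int.fract_eq_self.2 ⟨by positivity, by rwa [div_lt_one hP]⟩]
    congr 1
    field_simp
  have hUm : Measurable U := hu.1.measurable.comp
    ((measurable_fract.comp (measurable_id.div_const _)).const_mul _)
  have hWm : Measurable W := hu.1.measurable.indicator measurableSet_Iio
  have hWC : ∀ t, ‖W t‖ ≤ C := fun t => (norm_indicator_le_norm_self _ _).trans (hCu t)
  have hper : Function.Periodic U (2 * T) := fun t => by
    simp only [hUdef]
    rw [add_div, div_self hP.ne', Int.fract_add_one]
  have hM : ∀ x : ℝ, ‖∫ t in 0..(2 * T), Complex.exp (x * t * Complex.I) * U t‖ ≤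
      Real.sqrt (ρ / (16 * C ^ 2)) * (2 * T) := fun x => by
    have := hunif (2 * T) (by linarith) x 0
    rw [zero_add] at this
    convert this using 2
    refine intervalIntegral.integral_congr_ae ?_
    have hae : ∀ᵐ t : ℝ, t ≠ 2 * T := by simp [ae_iff]
    filter_upwards [hae] with t ht ht'
    rw [uIoc_of_le hP.le] at ht'
    rw [hUeq t ht'.1.le (lt_of_le_of_ne ht'.2 ht), mul_comm]
  have hmain := integral_norm_sq_correlation_le hP hUm hWm (fun t => hCu _) hWC hper hM
  set G : ℝ → ℂ := fun x => ∫ t in 0..T, u (t + x) * (starRingEnd ℂ) (u t) with hG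
  have hGc : Continuous G := by
    have : Continuous (Function.uncurry fun x t => u (t + x) * (starRingEnd ℂ) (u t)) :=
      (hu.1.comp (by fun_prop)).mul (Complex.continuous_conj.comp (hu.1.comp (by fun_prop)))
    exact intervalIntegral.continuous_parametric_intervalIntegral_of_continuous' this 0 T
  have hGeq : ∀ x ∈ Ico 0 T, ∫ t in 0..(2 * T), U (t + x) * (starRingEnd ℂ) (W t) = G x := by
    intro x hx
    have hWint : ∀ a b, IntervalIntegrable (fun t => U (t + x) * (starRingEnd ℂ) (W t)) volume a b := by
      intro a b
      refine (intervalIntegrable_const (c := C * C)).mono_fun ?_ (Eventually.of_forall fun t => ?_)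
      · exact ((hUm.comp (measurable_id.add_const x)).mul
          (Complex.continuous_conj.measurable.comp hWm)).aestronglyMeasurable
      · beta_reduce
        rw [norm_mul, RCLike.norm_conj, Real.norm_of_nonneg (show 0 ≤ C * C by positivity)]
        exact mul_le_mul (hCu _) (hWC _) (norm_nonneg _) hC.le
    rw [← intervalIntegral.integral_add_adjacent_intervals (hWint 0 T) (hWint T (2 * T))]
    have z : ∫ t in T..(2 * T), U (t + x) * (starRingEnd ℂ) (W t) = 0 := by
      refine intervalIntegral.integral_zero_ae (Eventually.of_forall fun t ht => ?_)
      rw [uIoc_of_le (by linarith)] at ht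
      have : W t = 0 := indicator_of_notMem (by simpa using ht.1.le) _
      rw [this, map_zero, mul_zero]
    rw [z, add_zero]
    refine intervalIntegral.integral_congr_ae ?_
    have hae : ∀ᵐ t : ℝ, t ≠ T := by simp [ae_iff]
    filter_upwards [hae] with t ht ht'
    rw [uIoc_of_le hTpos.le] at ht'
    have htT := lt_of_le_of_ne ht'.2 ht
    rw [hUeq (t + x) (by linarith [ht'.1, hx.1]) (by linarith [hx.2]),
      show W t = u t from indicator_of_mem (by exact htT) _]
  have hGlow : ∀ x, (∀ t, ‖u (t + x) - u t‖ ≤ κ / (2 * C)) → κ * T / 2 ≤ ‖G x‖ := by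
    intro x hx
    have hconj : Continuous fun t => (starRingEnd ℂ) (u t) := Complex.continuous_conj.comp hu.1
    have hshift : Continuous fun t => u (t + x) := hu.1.comp (by fun_prop)
    have e : G x = (∫ t in 0..T, (u (t + x) - u t) * (starRingEnd ℂ) (u t)) +
        ((∫ t in 0..T, ‖u t‖ ^ 2 : ℝ) : ℂ) := by
      have hd : Continuous fun t => (u (t + x) - u t) * (starRingEnd ℂ) (u t) :=
        (hshift.sub hu.1).mul hconj
      have hn : Continuous fun t => ((‖u t‖ ^ 2 : ℝ) : ℂ) :=
        Complex.continuous_ofReal.comp (hu.1.norm.pow 2)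
      rw [← intervalIntegral.integral_ofReal, ← intervalIntegral.integral_add
        (hd.intervalIntegrable _ _) (hn.intervalIntegrable _ _)]
      refine intervalIntegral.integral_congr fun t _ => ?_
      simp only [Complex.ofReal_pow, ← Complex.mul_conj']
      ring
    have h1 : ‖∫ t in 0..T, (u (t + x) - u t) * (starRingEnd ℂ) (u t)‖ ≤ κ / 2 * T := by
      refine (intervalIntegral.norm_integral_le_of_norm_le_const (C := κ / 2) fun t _ => ?_).trans
        (by rw [sub_zero, abs_of_pos hTpos])
      rw [norm_mul, RCLike.norm_conj]
      refine (mul_le_mul (hx t) (hCu t) (norm_nonneg _) (by positivity)).trans (le_of_eq ?_)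
      field_simp
    have h2 := hlow T hT1
    have h3 : ‖((∫ t in 0..T, ‖u t‖ ^ 2 : ℝ) : ℂ)‖ = ∫ t in 0..T, ‖u t‖ ^ 2 := by
      rw [Complex.norm_real, Real.norm_of_nonneg]
      exact le_trans (by positivity) h2
    have h4 := norm_sub_norm_le ((∫ t in 0..T, ‖u t‖ ^ 2 : ℝ) : ℂ)
      (-∫ t in 0..T, (u (t + x) - u t) * (starRingEnd ℂ) (u t))
    rw [sub_neg_eq_add, add_comm, ← e, norm_neg, h3] at h4
    linarith
  have hG2 : ρ * T ^ 3 ≤ ∫ x in 0..T, ‖G x‖ ^ 2 := by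
    have hGc2 : Continuous fun x => ‖G x‖ ^ 2 := hGc.norm.pow 2
    have hκ' : 0 ≤ 2 * δ * (κ * T / 2) ^ 2 := by positivity
    have h1 := le_integral_of_blocks (fun x => by positivity) hA hκ' hTpos.le hGc2
      fun c _ _ => by
        obtain ⟨p, hp1, hp2, hp⟩ := hint c
        refine le_integral_of_subinterval (fun x => by positivity) hGc2 hδ.le hp1 hp2
          fun x hx => ?_
        exact pow_le_pow_left₀ (by positivity) (hGlow x (hp x hx)) 2
    refine le_trans ?_ h1
    have h2 : T / (2 * A) ≤ T / A - 1 := by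
      rw [show T / (2 * A) = T / A - T / (2 * A) by field_simp; ring]
      have : 1 ≤ T / (2 * A) := by rwa [le_div_iff₀ (by positivity), one_mul]
      linarith
    refine le_trans (le_of_eq ?_) (mul_le_mul_of_nonneg_left h2 hκ')
    rw [hρ]
    field_simp
    ring
  have hup : ∫ t in 0..(2 * T), ‖W t‖ ^ 2 ≤ C ^ 2 * (2 * T) := by
    have := intervalIntegral.norm_integral_le_of_norm_le_const (a := 0) (b := 2 * T) (C := C ^ 2)
      (f := fun t => ‖W t‖ ^ 2) fun t _ => by
        rw [norm_pow, norm_norm]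
        exact pow_le_pow_left₀ (norm_nonneg _) (hWC t) 2
    rw [sub_zero, abs_of_pos hP] at this
    exact (le_abs_self _).trans this
  have hlow2 : ∫ x in 0..T, ‖G x‖ ^ 2 ≤
      ∫ x in 0..(2 * T), ‖∫ t in 0..(2 * T), U (t + x) * (starRingEnd ℂ) (W t)‖ ^ 2 := by
    have hF : StronglyMeasurable fun x =>
        ∫ t in 0..(2 * T), U (t + x) * (starRingEnd ℂ) (W t) := by
      have : Measurable fun p : ℝ × ℝ => U (p.2 + p.1) * (starRingEnd ℂ) (W p.2) :=
        (hUm.comp (measurable_snd.add measurable_fst)).mul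
          (Complex.continuous_conj.measurable.comp (hWm.comp measurable_snd))
      simp only [intervalIntegral.integral_of_le hP.le]
      exact this.stronglyMeasurable.integral_prod_right
    have hFi : IntervalIntegrable (fun x =>
        ‖∫ t in 0..(2 * T), U (t + x) * (starRingEnd ℂ) (W t)‖ ^ 2) volume 0 (2 * T) := by
      refine (intervalIntegrable_const (c := (C * C * (2 * T)) ^ 2)).mono_fun
        (hF.norm.pow 2).aestronglyMeasurable (Eventually.of_forall fun x => ?_)
      beta_reduce
      rw [norm_pow, norm_norm, Real.norm_of_nonneg (show 0 ≤ (C * C * (2 * T)) ^ 2 by positivity)]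
      refine pow_le_pow_left₀ (norm_nonneg _) ?_ 2
      refine (intervalIntegral.norm_integral_le_of_norm_le_const (C := C * C) fun t _ => ?_).trans
        (by rw [sub_zero, abs_of_pos hP])
      rw [norm_mul, RCLike.norm_conj]
      exact mul_le_mul (hCu _) (hWC _) (norm_nonneg _) hC.le
    have e : ∫ x in 0..T, ‖G x‖ ^ 2 =
        ∫ x in 0..T, ‖∫ t in 0..(2 * T), U (t + x) * (starRingEnd ℂ) (W t)‖ ^ 2 := by
      refine intervalIntegral.integral_congr_ae ?_
      have hae : ∀ᵐ t : ℝ, t ≠ T := by simp [ae_iff]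
      filter_upwards [hae] with t ht ht'
      rw [uIoc_of_le hTpos.le] at ht'
      rw [hGeq t ⟨ht'.1.le, lt_of_le_of_ne ht'.2 ht⟩]
    rw [e]
    exact intervalIntegral.integral_mono_interval le_rfl hTpos.le (by linarith)
      (Eventually.of_forall fun x => by positivity) hFi
  have hfin : ρ * T ^ 3 ≤ ρ / (16 * C ^ 2) * (2 * T) ^ 2 * (C ^ 2 * (2 * T)) := by
    refine (hG2.trans hlow2).trans (hmain.trans ?_)
    rw [mul_pow, Real.sq_sqrt (by positivity)]
    exact mul_le_mul_of_nonneg_left hup (by positivity)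
  have e : ρ / (16 * C ^ 2) * (2 * T) ^ 2 * (C ^ 2 * (2 * T)) = ρ * T ^ 3 / 2 := by
    field_simp
    ring
  rw [e] at hfin
  have : 0 < ρ * T ^ 3 := by positivity
  linarith

/-! ### Absolutely convergent series and the Dirichlet series of f -/

/-- Dominated convergence is used twice with the majorant |b_i|: to integrate term by term over [-T,
T], and to let T tend to infinity inside the sum. -/
theorem HasMean.tsum_mul_exp {ι : Type*} [Countable ι] {b : ι → ℂ} (hb : Summable fun i => ‖b i‖)
    (lam : ι → ℝ) (x : ℝ) :
    HasMean (fun t => (∑' i, b i * Complex.exp (lam i * t * Complex.I)) *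
        Complex.exp (x * t * Complex.I))
      (∑' i, b i * if lam i + x = 0 then 1 else 0) := by
  have hterm : ∀ i (t : ℝ), b i * Complex.exp (lam i * t * Complex.I) *
      Complex.exp (x * t * Complex.I) = b i * Complex.exp ((lam i + x : ℝ) * t * Complex.I) := by
    intro i t
    rw [mul_assoc, ← Complex.exp_add]
    congr 2
    push_cast
    ring
  have hnorm : ∀ i (t : ℝ), ‖b i * Complex.exp ((lam i + x : ℝ) * t * Complex.I)‖ = ‖b i‖ :=
    fun i t => by rw [norm_mul, norm_cexp_mul_I, mul_one]
  have hint : ∀ T : ℝ, HasSum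
      (fun i => ∫ t in (-T)..T, b i * Complex.exp ((lam i + x : ℝ) * t * Complex.I))
      (∫ t in (-T)..T, (∑' i, b i * Complex.exp (lam i * t * Complex.I)) *
        Complex.exp (x * t * Complex.I)) := fun T => by
    refine intervalIntegral.hasSum_integral_of_dominated_convergence (fun i _ => ‖b i‖)
      (fun i => ?_) (fun i => ?_) ?_ ?_ ?_
    · exact (continuous_const.mul (continuous_cexp_mul_I _)).aestronglyMeasurable
    · exact Eventually.of_forall fun t _ => (hnorm i t).le
    · exact Eventually.of_forall fun t _ => hb
    · exact intervalIntegrable_const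
    · refine Eventually.of_forall fun t _ => ?_
      have hs : Summable fun i => b i * Complex.exp (lam i * t * Complex.I) :=
        Summable.of_norm (by simpa only [norm_mul, norm_cexp_mul_I, mul_one] using hb)
      simpa only [hterm] using hs.hasSum.mul_right (Complex.exp (x * t * Complex.I))
  have hlim : Tendsto (fun T : ℝ => ∑' i, ((2 * T)⁻¹ : ℝ) •
      ∫ t in (-T)..T, b i * Complex.exp ((lam i + x : ℝ) * t * Complex.I)) atTop
      (𝓝 (∑' i, b i * if lam i + x = 0 then 1 else 0)) := by
    refine tendsto_tsum_of_dominated_convergence hb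
      (fun i => (HasMean.exp (lam i + x)).const_mul (b i)) ?_
    filter_upwards [eventually_gt_atTop 0] with T hT i
    have := HasMean.norm_mean_le (u := fun t => b i * Complex.exp ((lam i + x : ℝ) * t * Complex.I))
      (w := fun _ => ((‖b i‖ : ℝ) : ℂ)) continuous_const hT
      (fun t => by rw [hnorm, Complex.ofReal_re])
    refine this.trans (le_of_eq ?_)
    rw [intervalIntegral.integral_const, smul_smul, Complex.smul_re, Complex.ofReal_re, smul_eq_mul]
    field_simp
    ring
  refine hlim.congr fun T => ?_
  rw [((hint T).const_smul ((2 * T)⁻¹ : ℝ)).tsum_eq]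

theorem tsum_mul_ite_add_eq_zero {ι : Type*} {lam : ι → ℝ} (hinj : Function.Injective lam)
    (b : ι → ℂ) (i : ι) : (∑' j, b j * if lam j + -lam i = 0 then 1 else 0) = b i := by
  rw [tsum_eq_single i]
  · simp
  · intro j hj
    rw [if_neg, mul_zero]
    intro h
    exact hj (hinj (by linarith))

theorem isOpen_strip (α β : EReal) : IsOpen (strip α β) :=
  (isOpen_Ioo (a := α) (b := β)).preimage
    (continuous_coe_real_ereal.comp Complex.continuous_re)

theorem mem_strip_of_re {α β : EReal} {σ : ℝ} (h1 : α < σ) (h2 : (σ : EReal) < β) (t : ℝ) :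
    (σ + t * Complex.I : ℂ) ∈ strip α β := by
  simp [strip, h1, h2]

theorem IsAlmostPeriodic.isAP {α β : EReal} {f : ℂ → ℂ} (hf : IsAlmostPeriodic α β f) {σ : ℝ}
    (h1 : α < σ) (h2 : (σ : EReal) < β) : IsAP fun t : ℝ => f (σ + t * Complex.I) := by
  constructor
  · refine hf.1.continuousOn.comp_continuous (by fun_prop) fun t => mem_strip_of_re h1 h2 t
  · intro ε hε
    obtain ⟨l, hl, h⟩ := hf.2 σ σ h1 le_rfl h2 ε hε
    refine ⟨l, hl, fun t₀ => ?_⟩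
    obtain ⟨τ, hτ, h'⟩ := h t₀
    refine ⟨τ, hτ, fun t => ?_⟩
    have := h' (σ + t * Complex.I) (by simp)
    convert this using 4
    push_cast
    ring

theorem HasDirichletCoeff.hasMean {α β : EReal} {f : ℂ → ℂ} {x : ℝ} {c : ℂ}
    (h : HasDirichletCoeff α β f x c) {σ : ℝ} (h1 : α < σ) (h2 : (σ : EReal) < β) :
    HasMean (fun t => f (σ + t * Complex.I) * Complex.exp ((-x : ℝ) * t * Complex.I))
      (c * Complex.exp (x * σ)) := by
  have := HasMean.const_mul (u := fun t : ℝ =>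
    f (σ + t * Complex.I) * Complex.exp (-(x * (σ + t * Complex.I)))) (h σ h1 h2)
    (Complex.exp (x * σ))
  rw [mul_comm c]
  refine this.congr fun T => ?_
  congr 1
  refine intervalIntegral.integral_congr fun t _ => ?_
  rw [mul_left_comm, ← Complex.exp_add]
  congr 2
  push_cast
  ring

theorem IsDirichletSeries.exists_coeff {ι : Type*} {α β : EReal} {f : ℂ → ℂ} {a : ι → ℂ}
    {lam : ι → ℝ} (hf : IsDirichletSeries α β f a lam) : ∃ c : ℝ → ℂ,
      (∀ x, HasDirichletCoeff α β f x (c x)) ∧ (∀ i, c (lam i) = a i) ∧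
        ∀ x, x ∉ range lam → c x = 0 := by
  have h : ∀ x, ∃ c, HasDirichletCoeff α β f x c ∧ (∀ i, lam i = x → c = a i) ∧
      (x ∉ range lam → c = 0) := by
    intro x
    by_cases hx : x ∈ range lam
    · obtain ⟨i, rfl⟩ := hx
      exact ⟨a i, hf.coeff i, fun j hj => by rw [hf.injective hj], fun h => absurd ⟨i, rfl⟩ h⟩
    · exact ⟨0, hf.coeff_eq_zero x hx, fun i hi => absurd ⟨i, hi⟩ hx, fun _ => rfl⟩
  choose c h1 h2 h3 using h
  exact ⟨c, h1, fun i => h2 _ i rfl, h3⟩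

theorem norm_mul_cexp_mul_ofReal (a : ℂ) (x σ : ℝ) :
    ‖a * Complex.exp (x * σ)‖ = ‖a‖ * Real.exp (x * σ) := by
  rw [norm_mul, ← Complex.ofReal_mul, Complex.norm_exp_ofReal]

/-- The Dirichlet series of an almost periodic function with linearly independent exponents
converges absolutely in the strip. -/
theorem IsDirichletSeries.summable {ι : Type*} {α β : EReal} {f : ℂ → ℂ} {a : ι → ℂ}
    {lam : ι → ℝ} (hf : IsDirichletSeries α β f a lam) (hap : IsAlmostPeriodic α β f)
    (hind : LinearIndependent ℚ lam) {σ : ℝ} (h1 : α < σ) (h2 : (σ : EReal) < β) :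
    Summable fun i => ‖a i‖ * Real.exp (lam i * σ) := by
  obtain ⟨c, hc, hca, hc0⟩ := hf.exists_coeff
  have hu := hap.isAP h1 h2
  obtain ⟨C, -, hC⟩ := hu.exists_bound
  refine summable_of_sum_le (c := 2 * C) (fun i => by positivity) fun F => ?_
  -- Testing against e^{iyt} picks out the exponent -y, hence the signs in m.
  have := sum_norm_coeff_le hind hu.1 hC (b := fun i => a i * Complex.exp (lam i * σ))
    (m := fun y => c (-y) * Complex.exp ((-y : ℝ) * σ)) (fun y => by
      have := (hc (-y)).hasMean h1 h2
      rwa [neg_neg] at this)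
    (fun i => by simp [hca]) (fun y hy => by simp [hc0 (-y) hy]) F
  simpa only [norm_mul_cexp_mul_ofReal] using this

/-- An almost periodic function with linearly independent exponents is the sum of its Dirichlet
series. -/
theorem IsDirichletSeries.eq_tsum {ι : Type*} [Countable ι] {α β : EReal} {f : ℂ → ℂ} {a : ι → ℂ}
    {lam : ι → ℝ} (hf : IsDirichletSeries α β f a lam) (hap : IsAlmostPeriodic α β f)
    (hind : LinearIndependent ℚ lam) {s : ℂ} (hs : s ∈ strip α β) :
    f s = ∑' i, a i * Complex.exp (lam i * s) := by
  obtain ⟨h1, h2⟩ := hs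
  set σ := s.re with hσ
  obtain ⟨c, hc, hca, hc0⟩ := hf.exists_coeff
  have hu := hap.isAP h1 h2
  have hsum := hf.summable hap hind h1 h2
  set b : ι → ℂ := fun i => a i * Complex.exp (lam i * σ) with hb
  have hbs : Summable fun i => ‖b i‖ := by
    simpa only [hb, norm_mul_cexp_mul_ofReal] using hsum
  have hg := IsAP.tsum_exp hbs lam
  -- On the line Re s = σ, f and the sum of its series have the same Fourier coefficients.
  have hz := (hu.sub hg).eq_zero (fun y => by
    have m1 := (hc (-y)).hasMean h1 h2
    rw [neg_neg] at m1
    have m2 := HasMean.tsum_mul_exp hbs lam y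
    have e : (∑' i, b i * if lam i + y = 0 then 1 else 0) = c (-y) * Complex.exp ((-y : ℝ) * σ) := by
      by_cases hy : -y ∈ range lam
      · obtain ⟨i, hi⟩ := hy
        have := tsum_mul_ite_add_eq_zero hf.injective b i
        rw [hi, neg_neg] at this
        rw [this, ← hi, hca]
      · rw [hc0 _ hy, zero_mul]
        refine (tsum_congr fun i => ?_).trans tsum_zero
        rw [if_neg fun h => hy ⟨i, by linarith⟩, mul_zero]
    have := m1.sub (hu.1.mul (continuous_cexp_mul_I y)) (hg.1.mul (continuous_cexp_mul_I y)) m2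
    rw [e, sub_self] at this
    simpa only [sub_mul, Pi.mul_apply] using this) s.im
  have h3 := sub_eq_zero.1 hz
  rw [hσ, Complex.re_add_im] at h3
  rw [h3]
  refine tsum_congr fun i => ?_
  simp only [hb]
  rw [mul_assoc, ← Complex.exp_add]
  congr 2
  conv_rhs => rw [← Complex.re_add_im s]
  ring

/-! ### Rotating the coefficients, and transferring a zero to f -/

/-- Kronecker's theorem for infinitely many frequencies, with summable weights. -/
theorem exists_tsum_mul_norm_exp_sub_le {ι : Type*} {lam : ι → ℝ} (hind : LinearIndependent ℚ lam)
    (θ : ι → ℝ) {c : ι → ℝ} (hc0 : ∀ i, 0 ≤ c i) (hc : Summable c) {η : ℝ} (hη : 0 < η) :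
    ∃ t : ℝ, (Summable fun i =>
        c i * ‖Complex.exp (lam i * t * Complex.I) - Complex.exp (θ i * Complex.I)‖) ∧
      ∑' i, c i * ‖Complex.exp (lam i * t * Complex.I) - Complex.exp (θ i * Complex.I)‖ ≤ η := by
  classical
  obtain ⟨F, hF⟩ := ((tendsto_tsum_compl_atTop_zero c).eventually (gt_mem_nhds
    (show (0 : ℝ) < η / 4 by linarith))).exists
  set S := ∑' i, c i with hS
  have hS0 : 0 ≤ S := tsum_nonneg hc0
  have hlinF : LinearIndependent ℚ fun j : F => lam j := hind.comp _ Subtype.val_injective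
  -- Each phase difference is at most 2, so the tail outside F costs at most η/2; this accuracy
  -- makes F cost the other half. The +1 guards against S = 0.
  obtain ⟨t, ht⟩ := exists_forall_norm_exp_sub_le hlinF (fun j => θ j)
    (ε := η / (2 * (S + 1))) (by positivity)
  set d : ι → ℝ := fun i => ‖Complex.exp (lam i * t * Complex.I) - Complex.exp (θ i * Complex.I)‖
    with hd
  have hd2 : ∀ i, d i ≤ 2 := fun i => by
    refine (norm_sub_le _ _).trans ?_
    rw [norm_cexp_mul_I, Complex.norm_exp_ofReal_mul_I]
    norm_num
  have hd0 : ∀ i, 0 ≤ d i := fun i => norm_nonneg _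
  have hsum : Summable fun i => c i * d i :=
    Summable.of_nonneg_of_le (fun i => mul_nonneg (hc0 i) (hd0 i))
      (fun i => mul_le_mul_of_nonneg_left (hd2 i) (hc0 i)) (hc.mul_right 2)
  refine ⟨t, hsum, ?_⟩
  change ∑' i, c i * d i ≤ η
  rw [← hsum.sum_add_tsum_compl (s := F)]
  have h1 : ∑ i ∈ F, c i * d i ≤ η / 2 := by
    calc ∑ i ∈ F, c i * d i ≤ ∑ i ∈ F, c i * (η / (2 * (S + 1))) :=
          Finset.sum_le_sum fun i hi => mul_le_mul_of_nonneg_left (ht ⟨i, hi⟩) (hc0 i)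
      _ = (∑ i ∈ F, c i) * (η / (2 * (S + 1))) := by rw [Finset.sum_mul]
      _ ≤ (S + 1) * (η / (2 * (S + 1))) := by
          refine mul_le_mul_of_nonneg_right ?_ (by positivity)
          linarith [hc.sum_le_tsum F fun i _ => hc0 i]
      _ = η / 2 := by field_simp
  have h2 : ∑' i : ↑((F : Set ι)ᶜ), c i * d i ≤ η / 2 := by
    have hcF : Summable fun i : ↑((F : Set ι)ᶜ) => c i := hc.subtype _
    calc ∑' i : ↑((F : Set ι)ᶜ), c i * d i ≤ ∑' i : ↑((F : Set ι)ᶜ), c i * 2 :=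
          (hsum.subtype ((F : Set ι)ᶜ)).tsum_le_tsum
            (fun i => mul_le_mul_of_nonneg_left (hd2 i) (hc0 i)) (hcF.mul_right 2)
      _ = (∑' i : ↑((F : Set ι)ᶜ), c i) * 2 := tsum_mul_right
      _ ≤ η / 2 := by
          have : ∑' i : ↑((F : Set ι)ᶜ), c i < η / 4 := hF
          linarith
  linarith

/-- As φ runs from 0 to π, |x + y e^{iφ}| passes from x + y to |x - y|, hence takes the value z; the
third side is then pointed the opposite way. -/
theorem exists_triangle {x y z : ℝ} (hx : 0 ≤ x) (hy : 0 ≤ y) (h1 : x ≤ y + z)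
    (h2 : y ≤ x + z) (h3 : z ≤ x + y) : ∃ φ ψ : ℝ,
      (x : ℂ) + y * Complex.exp (φ * Complex.I) + z * Complex.exp (ψ * Complex.I) = 0 := by
  have hc : ContinuousOn (fun φ : ℝ => ‖(x : ℂ) + y * Complex.exp (φ * Complex.I)‖)
      (Icc 0 Real.pi) := Continuous.continuousOn (by fun_prop)
  have hpi : ‖(x : ℂ) + y * Complex.exp ((Real.pi : ℝ) * Complex.I)‖ = |x - y| := by
    rw [Complex.exp_pi_mul_I, ← Real.norm_eq_abs, ← Complex.norm_real]
    congr 1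
    push_cast
    ring
  have h0 : ‖(x : ℂ) + y * Complex.exp ((0 : ℝ) * Complex.I)‖ = x + y := by
    rw [Complex.ofReal_zero, zero_mul, Complex.exp_zero, mul_one, ← Complex.ofReal_add,
      Complex.norm_real, Real.norm_of_nonneg (by positivity)]
  obtain ⟨φ, -, hφ⟩ := intermediate_value_Icc' Real.pi_pos.le hc
    (show z ∈ _ from ⟨by rw [hpi]; exact abs_le.2 ⟨by linarith, by linarith⟩, by rw [h0]; exact h3⟩)
  refine ⟨φ, Complex.arg ((x : ℂ) + y * Complex.exp (φ * Complex.I)) + Real.pi, ?_⟩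
  have := Complex.norm_mul_exp_arg_mul_I ((x : ℂ) + y * Complex.exp (φ * Complex.I))
  simp only at hφ
  rw [hφ] at this
  rw [Complex.ofReal_add, add_mul, Complex.exp_add, Complex.exp_pi_mul_I]
  linear_combination -this

/-- A family of nonnegative numbers none of which exceeds the sum of the others consists of the
sides of a closed polygon. -/
theorem exists_phases_tsum_eq_zero {ι : Type*} [Countable ι] {r : ι → ℝ} (hr0 : ∀ i, 0 ≤ r i)
    (hr : Summable r) (h : ∀ i, 2 * r i ≤ ∑' j, r j) :
    ∃ θ : ι → ℝ, ∑' i, (r i : ℂ) * Complex.exp (θ i * Complex.I) = 0 := by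
  obtain ⟨e, he⟩ := exists_injective_nat ι
  set S := ∑' j, r j with hS
  rcases (tsum_nonneg hr0).eq_or_lt with hS0 | hS0
  · have : ∀ i, r i = 0 := fun i => le_antisymm (by linarith [h i]) (hr0 i)
    exact ⟨0, by simp [this]⟩
  -- Stop at the first partial sum exceeding S/2. The terms before, the single last term and the
  -- terms after form three groups, each of total at most S/2, hence the sides of a triangle.
  set q : ℕ → ι → ℝ := fun n i => if e i < n then r i else 0 with hq
  have hq0 : ∀ n i, 0 ≤ q n i := fun n i => by
    simp only [hq]
    split_ifs
    · exact hr0 i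
    · exact le_rfl
  have hqr : ∀ n i, q n i ≤ r i := fun n i => by
    simp only [hq]
    split_ifs
    · exact le_rfl
    · exact hr0 i
  have hqs : ∀ n, Summable (q n) := fun n => Summable.of_nonneg_of_le (hq0 n) (hqr n) hr
  have hqmono : ∀ n i, q n i ≤ q (n + 1) i := fun n i => by
    simp only [hq]
    split_ifs
    · exact le_rfl
    · omega
    · exact hr0 i
    · exact le_rfl
  have hlim : Tendsto (fun n => ∑' i, q n i) atTop (𝓝 S) := by
    refine tendsto_tsum_of_dominated_convergence hr (fun i => ?_)
      (Eventually.of_forall fun n i => ?_)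
    · refine tendsto_const_nhds.congr' ?_
      filter_upwards [eventually_gt_atTop (e i)] with n hn
      simp [hq, hn]
    · rw [Real.norm_of_nonneg (hq0 n i)]
      exact hqr n i
  have hex : ∃ n, S / 2 < ∑' i, q n i := (hlim.eventually (lt_mem_nhds (by linarith))).exists
  classical
  obtain ⟨n, hn⟩ : ∃ n, Nat.find hex = n + 1 := by
    refine Nat.exists_eq_succ_of_ne_zero fun h0 => ?_
    have := Nat.find_spec hex
    rw [h0] at this
    simp only [hq, Nat.not_lt_zero, if_false, tsum_zero] at this
    linarith
  have hz : S / 2 < ∑' i, q (n + 1) i := hn ▸ Nat.find_spec hex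
  have hx : ∑' i, q n i ≤ S / 2 := not_lt.1 (Nat.find_min hex (by omega))
  have hxy : ∑' i, q n i ≤ ∑' i, q (n + 1) i := (hqs n).tsum_le_tsum (hqmono n) (hqs (n + 1))
  have hzS : ∑' i, q (n + 1) i ≤ S := (hqs (n + 1)).tsum_le_tsum (hqr (n + 1)) hr
  have hy : ∑' i, q (n + 1) i - ∑' i, q n i ≤ S / 2 := by
    rw [← (hqs (n + 1)).tsum_sub (hqs n)]
    by_cases hi : ∃ i, e i = n
    · obtain ⟨i, hi⟩ := hi
      rw [tsum_eq_single i]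
      · have : q (n + 1) i - q n i = r i := by simp [hq, hi]
        linarith [h i]
      · intro j hj
        have : e j ≠ n := fun hjn => hj (he (hjn.trans hi.symm))
        have : e j < n + 1 ↔ e j < n := by omega
        simp [hq, this]
    · push Not at hi
      have : ∀ j, q (n + 1) j - q n j = 0 := fun j => by
        have := hi j
        have : e j < n + 1 ↔ e j < n := by omega
        simp [hq, this]
      simp only [this, tsum_zero]
      linarith
  obtain ⟨φ, ψ, hφ⟩ := exists_triangle (x := ∑' i, q n i)
    (y := ∑' i, q (n + 1) i - ∑' i, q n i) (z := S - ∑' i, q (n + 1) i)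
    (tsum_nonneg (hq0 n)) (by linarith) (by linarith) (by linarith) (by linarith)
  refine ⟨fun i => if e i < n then 0 else if e i < n + 1 then φ else ψ, ?_⟩
  have c1 := Complex.hasSum_ofReal.2 (hqs n).hasSum
  have c2 := Complex.hasSum_ofReal.2 ((hqs (n + 1)).hasSum.sub (hqs n).hasSum)
  have c3 := Complex.hasSum_ofReal.2 (hr.hasSum.sub (hqs (n + 1)).hasSum)
  have := (c1.add (c2.mul_right (Complex.exp (φ * Complex.I)))).add
    (c3.mul_right (Complex.exp (ψ * Complex.I)))
  rw [hφ] at this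
  rw [← this.tsum_eq]
  refine tsum_congr fun i => ?_
  simp only [hq]
  by_cases h1 : e i < n
  · have h2 : e i < n + 1 := by omega
    simp [h1, h2]
  · by_cases h2 : e i < n + 1
    · simp [h1, h2]
    · simp [h1, h2]

theorem strip_coe_isPreconnected (p q : ℝ) : IsPreconnected (strip p q) := by
  have : strip p q = Complex.reCLM ⁻¹' Ioo p q := by
    ext s
    simp [strip]
  rw [this]
  exact ((convex_Ioo p q).is_linear_preimage Complex.reCLM.toLinearMap.isLinear).isPreconnected

/-- If the Dirichlet series of `f`, with its coefficients rotated, vanishes at the real point `σ`,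
then `f` has a zero in the strip. -/
theorem exists_zero_of_rotated_zero {ι : Type*} [Countable ι] [Nonempty ι] {α β : EReal}
    {f : ℂ → ℂ} {a : ι → ℂ} {lam : ι → ℝ} (hfa : AnalyticOnNhd ℂ f (strip α β))
    (ha : ∀ i, a i ≠ 0) (hind : LinearIndependent ℚ lam)
    (hsum : ∀ σ : ℝ, α < σ → (σ : EReal) < β → Summable fun i => ‖a i‖ * Real.exp (lam i * σ))
    (hf : ∀ s ∈ strip α β, f s = ∑' i, a i * Complex.exp (lam i * s)) (θ : ι → ℝ) {σ : ℝ}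
    (h1 : α < σ) (h2 : (σ : EReal) < β)
    (hzero : ∑' i, a i * Complex.exp (θ i * Complex.I) * Complex.exp (lam i * σ) = 0) :
    ∃ s ∈ strip α β, f s = 0 := by
  obtain ⟨p, hp1, hp2⟩ := EReal.lt_iff_exists_real_btwn.1 h1
  obtain ⟨q, hq1, hq2⟩ := EReal.lt_iff_exists_real_btwn.1 h2
  have hpσ : p < σ := by exact_mod_cast hp2
  have hσq : σ < q := by exact_mod_cast hq1
  have hVsub : strip p q ⊆ strip α β := fun s hs => ⟨hp1.trans hs.1, hs.2.trans hq2⟩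
  have hVre : ∀ s ∈ strip p q, p < s.re ∧ s.re < q := fun s hs =>
    ⟨by exact_mod_cast hs.1, by exact_mod_cast hs.2⟩
  -- On p < Re s < q each exponential is bounded by its value at one of the two ends, so B dominates
  -- the series and all its rotations.
  set B : ι → ℝ := fun i => ‖a i‖ * Real.exp (lam i * p) + ‖a i‖ * Real.exp (lam i * q) with hB
  have hB0 : ∀ i, 0 ≤ B i := fun i => by positivity
  have hBs : Summable B := (hsum p hp1 (hp2.trans h2)).add (hsum q (h1.trans hq1) hq2)
  have hbound : ∀ i, ∀ s ∈ strip p q, ‖a i‖ * ‖Complex.exp (lam i * s)‖ ≤ B i := by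
    intro i s hs
    obtain ⟨hs1, hs2⟩ := hVre s hs
    rw [Complex.norm_exp]
    have e : (lam i * s : ℂ).re = lam i * s.re := by simp
    rw [e, hB]
    simp only
    rw [← mul_add]
    refine mul_le_mul_of_nonneg_left ?_ (norm_nonneg _)
    rcases le_total 0 (lam i) with hl | hl
    · have : Real.exp (lam i * s.re) ≤ Real.exp (lam i * q) := Real.exp_le_exp.2 (by nlinarith)
      linarith [Real.exp_pos (lam i * p)]
    · have : Real.exp (lam i * s.re) ≤ Real.exp (lam i * p) := Real.exp_le_exp.2 (by nlinarith)
      linarith [Real.exp_pos (lam i * q)]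
  set ω : ι → ℂ := fun i => Complex.exp (θ i * Complex.I) with hω
  have hω1 : ∀ i, ‖ω i‖ = 1 := fun i => Complex.norm_exp_ofReal_mul_I _
  set g : ℂ → ℂ := fun s => ∑' i, a i * ω i * Complex.exp (lam i * s) with hg
  have hgb : ∀ i, ∀ s ∈ strip p q, ‖a i * ω i * Complex.exp (lam i * s)‖ ≤ B i := fun i s hs => by
    rw [norm_mul, norm_mul, hω1, mul_one]
    exact hbound i s hs
  have hgd : DifferentiableOn ℂ g (strip p q) :=
    Complex.differentiableOn_tsum_of_summable_norm hBs (fun i => by fun_prop) (isOpen_strip _ _) hgb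
  have hga : AnalyticOnNhd ℂ g (strip p q) := hgd.analyticOnNhd (isOpen_strip _ _)
  have hσV : (σ : ℂ) ∈ strip p q := by simpa [strip] using ⟨hpσ, hσq⟩
  have hgσ : g σ = 0 := hzero
  -- If g vanished near σ it would vanish on the whole vertical line, and so would its Fourier
  -- coefficients; but these are the nonzero b_i.
  have hgne : ¬ ∀ᶠ z in 𝓝 (σ : ℂ), g z = 0 := by
    intro hev
    have h0 := hga.eqOn_zero_of_preconnected_of_eventuallyEq_zero (strip_coe_isPreconnected p q)
      hσV hev
    obtain ⟨i⟩ := ‹Nonempty ι›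
    set b : ι → ℂ := fun i => a i * ω i * Complex.exp (lam i * σ) with hb
    have hbs : Summable fun i => ‖b i‖ :=
      Summable.of_nonneg_of_le (fun _ => norm_nonneg _) (fun i => hgb i σ hσV) hBs
    have hm := HasMean.tsum_mul_exp hbs lam (-lam i)
    rw [tsum_mul_ite_add_eq_zero hind.injective] at hm
    have hgl : ∀ t : ℝ, ∑' i, b i * Complex.exp (lam i * t * Complex.I) = 0 := fun t => by
      have := h0 (mem_strip_of_re (α := p) (β := q) hp2 hq1 t)
      simp only [hg, Pi.zero_apply] at this
      rw [← this]
      refine tsum_congr fun i => ?_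
      simp only [hb]
      rw [mul_assoc _ (Complex.exp _), ← Complex.exp_add]
      congr 2
      ring
    simp only [hgl, zero_mul] at hm
    have hbi := HasMean.zero.unique hm
    have : b i ≠ 0 := mul_ne_zero (mul_ne_zero (ha i) (Complex.exp_ne_zero _)) (Complex.exp_ne_zero _)
    exact this hbi.symm
  have hev := ((hga σ hσV).eventually_eq_zero_or_eventually_ne_zero).resolve_left hgne
  rw [eventually_nhdsWithin_iff] at hev
  obtain ⟨R, hR, hRs⟩ := Metric.eventually_nhds_iff_ball.1
    (hev.and ((isOpen_strip (p : EReal) q).mem_nhds hσV))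
  set ρ := R / 2 with hρ
  have hρ0 : 0 < ρ := by positivity
  have hcb : Metric.closedBall (σ : ℂ) ρ ⊆ strip p q := fun z hz =>
    (hRs z (Metric.closedBall_subset_ball (by linarith) hz)).2
  have hsne : ∀ z ∈ Metric.sphere (σ : ℂ) ρ, g z ≠ 0 := fun z hz =>
    (hRs z (Metric.closedBall_subset_ball (by linarith) (Metric.sphere_subset_closedBall hz))).1
      (Metric.ne_of_mem_sphere hz hρ0.ne')
  have hnes : (Metric.sphere (σ : ℂ) ρ).Nonempty := NormedSpace.sphere_nonempty.2 hρ0.le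
  obtain ⟨z₀, hz₀, hmin⟩ := (isCompact_sphere (σ : ℂ) ρ).exists_isMinOn hnes
    ((hgd.continuousOn.mono (Metric.sphere_subset_closedBall.trans hcb)).norm)
  set δ := ‖g z₀‖ with hδ
  have hδ0 : 0 < δ := norm_pos_iff.2 (hsne z₀ hz₀)
  -- With error δ/8, the translate h has |h(σ)| ≤ δ/8 < δ/4 and differs from h(σ) by at least δ/2 on
  -- the circle. The quantitative open mapping theorem covers the ball of radius δ/4 about h(σ),
  -- which contains 0.
  obtain ⟨t, hts, ht⟩ := exists_tsum_mul_norm_exp_sub_le hind θ hB0 hBs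
    (η := δ / 8) (by positivity)
  set h : ℂ → ℂ := fun s => f (s + t * Complex.I) with hh
  have hshift : ∀ s ∈ strip p q, s + t * Complex.I ∈ strip α β := fun s hs =>
    hVsub (by simpa [strip] using hs)
  have hha : AnalyticOnNhd ℂ h (strip p q) := fun s hs =>
    (hfa _ (hshift s hs)).comp_of_eq (by fun_prop) rfl
  have hclose : ∀ s ∈ strip p q, ‖h s - g s‖ ≤ δ / 8 := by
    intro s hs
    have hgs : Summable fun i => a i * ω i * Complex.exp (lam i * s) :=
      Summable.of_norm_bounded hBs fun i => hgb i s hs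
    have he : ∀ i, a i * Complex.exp (lam i * (s + t * Complex.I)) =
        a i * Complex.exp (lam i * t * Complex.I) * Complex.exp (lam i * s) := fun i => by
      rw [mul_assoc, ← Complex.exp_add]
      congr 2
      ring
    have hhs : Summable fun i => a i * Complex.exp (lam i * (s + t * Complex.I)) :=
      Summable.of_norm_bounded hBs fun i => by
        rw [he, norm_mul, norm_mul, norm_cexp_mul_I, mul_one]
        exact hbound i s hs
    simp only [hh, hg]
    rw [hf _ (hshift s hs), ← hhs.tsum_sub hgs]
    refine (tsum_of_norm_bounded hts.hasSum fun i => ?_).trans ht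
    rw [he, ← sub_mul, ← mul_sub, norm_mul, norm_mul, mul_right_comm]
    exact mul_le_mul_of_nonneg_right (hbound i s hs) (norm_nonneg _)
  have hhσ : ‖h σ‖ ≤ δ / 8 := by simpa [hgσ] using hclose σ hσV
  have hsph : ∀ z ∈ Metric.sphere (σ : ℂ) ρ, δ / 2 ≤ ‖h z - h σ‖ := by
    intro z hz
    have c1 := hclose z (hcb (Metric.sphere_subset_closedBall hz))
    have c2 : δ ≤ ‖g z‖ := hmin hz
    have c3 := norm_sub_norm_le (g z) (h z)
    rw [norm_sub_rev] at c3
    have c4 := norm_sub_norm_le (h z) (h σ)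
    linarith
  have hdc : DiffContOnCl ℂ h (Metric.ball (σ : ℂ) ρ) := by
    refine DifferentiableOn.diffContOnCl ?_
    rw [closure_ball _ hρ0.ne']
    exact hha.differentiableOn.mono hcb
  -- Local constancy of h at σ would spread to the circle, against the lower bound there.
  have hfreq : ∃ᶠ z in 𝓝 (σ : ℂ), h z ≠ h σ := by
    intro hcon
    have hcon' : h =ᶠ[𝓝 (σ : ℂ)] fun _ => h σ := hcon.mono fun z hz => not_not.1 hz
    have := hha.eqOn_of_preconnected_of_eventuallyEq analyticOnNhd_const
      (strip_coe_isPreconnected p q) hσV hcon' (hcb (Metric.sphere_subset_closedBall hz₀))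
    have h3 := hsph z₀ hz₀
    rw [this, sub_self, norm_zero] at h3
    linarith
  have hsub := hdc.ball_subset_image_closedBall hρ0 hsph hfreq
  obtain ⟨s, hs, hs0⟩ := hsub (show (0 : ℂ) ∈ Metric.ball (h σ) (δ / 2 / 2) by
    rw [Metric.mem_ball, dist_zero_left]
    linarith)
  exact ⟨_, hshift s (hcb hs), hs0⟩

/-! ### The endpoint conditions -/

theorem absTerm_coe {ι : Type*} (a : ι → ℂ) (lam : ι → ℝ) (σ : ℝ) (i : ι) :
    absTerm a lam σ i = ENNReal.ofReal (‖a i‖ * Real.exp (lam i * σ)) := by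
  rw [absTerm, ← EReal.coe_mul, EReal.exp_coe, ENNReal.ofReal_mul (norm_nonneg _), ofReal_norm,
    mul_comm σ]

theorem absTerm_neg {ι : Type*} (a : ι → ℂ) (lam : ι → ℝ) (σ : EReal) (i : ι) :
    absTerm a (fun i => -lam i) (-σ) i = absTerm a lam σ i := by
  rw [absTerm, absTerm, EReal.coe_neg, neg_mul_neg]

/-- The endpoint condition cannot hold at -∞: a negative exponent makes the supremum infinite, while
if all exponents are positive the sum tends to 0. -/
theorem not_two_mul_iSup_absTerm_bot_lt {ι : Type*} {β : EReal} (hβ : ⊥ < β) {a : ι → ℂ}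
    {lam : ι → ℝ} (ha : ∀ i, a i ≠ 0) (hlam : ∀ i, lam i ≠ 0)
    (hsum : ∀ σ : ℝ, (σ : EReal) < β → Summable fun i => ‖a i‖ * Real.exp (lam i * σ)) {L : ENNReal}
    (hL : Tendsto (fun σ : EReal => ∑' i, absTerm a lam σ i) (𝓝[>] ⊥) (𝓝 L)) :
    ¬ 2 * (⨆ i, absTerm a lam ⊥ i) < L := by
  intro hlt
  by_cases hneg : ∃ i, lam i < 0
  · obtain ⟨i, hi⟩ := hneg
    have h1 : absTerm a lam ⊥ i = ⊤ := by
      rw [absTerm, EReal.bot_mul_coe_of_neg hi, EReal.exp_top, ENNReal.mul_top]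
      simpa using ha i
    have h2 : (⨆ i, absTerm a lam ⊥ i) = ⊤ := top_unique (h1 ▸ le_iSup (absTerm a lam ⊥) i)
    rw [h2, ENNReal.mul_top two_ne_zero] at hlt
    exact not_top_lt hlt
  · push Not at hneg
    have hpos : ∀ i, 0 < lam i := fun i => lt_of_le_of_ne (hneg i) (hlam i).symm
    obtain ⟨σ, -, hσ⟩ := EReal.lt_iff_exists_real_btwn.1 hβ
    have hlim : Tendsto (fun t : ℝ => ∑' i, ‖a i‖ * Real.exp (lam i * t)) atBot (𝓝 0) := by
      have := tendsto_tsum_of_dominated_convergence (𝓕 := (atBot : Filter ℝ))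
        (f := fun t i => ‖a i‖ * Real.exp (lam i * t)) (g := fun _ => (0 : ℝ)) (hsum σ hσ)
        (fun i => by
          have := (Real.tendsto_exp_atBot.comp
            (tendsto_id.const_mul_atBot (hpos i))).const_mul ‖a i‖
          simpa using this)
        (by
          filter_upwards [eventually_le_atBot σ] with t ht i
          rw [Real.norm_of_nonneg (by positivity)]
          have := (hpos i).le
          gcongr)
      simpa using this
    have hbot : Tendsto (fun t : ℝ => (t : EReal)) atBot (𝓝[>] ⊥) :=
      tendsto_nhdsWithin_iff.2 ⟨EReal.tendsto_coe_nhds_bot_iff.2 tendsto_id,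
        Eventually.of_forall fun t => EReal.bot_lt_coe t⟩
    have hL0 : L = 0 := by
      refine tendsto_nhds_unique (hL.comp hbot) ?_
      have := ENNReal.tendsto_ofReal hlim
      rw [ENNReal.ofReal_zero] at this
      refine this.congr' ?_
      filter_upwards [eventually_le_atBot σ] with t ht
      rw [ENNReal.ofReal_tsum_of_nonneg (fun i => by positivity)
        (hsum t (lt_of_le_of_lt (by exact_mod_cast ht) hσ))]
      simp only [Function.comp, absTerm_coe]
    rw [hL0] at hlt
    exact not_lt_zero hlt

/-- Otherwise, at σ = (1 - t)α + tb the sum is less than twice its dominant term, which by convexity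
of exp is at most (1 - t)M + tS. Letting t tend to 0 gives L ≤ 2M. -/
theorem exists_no_dominant_term_left {ι : Type*} {α β : EReal} (hαβ : α < β) {a : ι → ℂ}
    {lam : ι → ℝ} (ha : ∀ i, a i ≠ 0) (hlam : ∀ i, lam i ≠ 0)
    (hsum : ∀ σ : ℝ, α < σ → (σ : EReal) < β → Summable fun i => ‖a i‖ * Real.exp (lam i * σ))
    {L : ENNReal}
    (hL : Tendsto (fun σ : EReal => ∑' i, absTerm a lam σ i) (𝓝[>] α) (𝓝 L))
    (hlt : 2 * (⨆ i, absTerm a lam α i) < L) :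
    ∃ σ : ℝ, α < σ ∧ (σ : EReal) < β ∧
      ∀ i, 2 * (‖a i‖ * Real.exp (lam i * σ)) ≤ ∑' j, ‖a j‖ * Real.exp (lam j * σ) := by
  induction α with
  | top => exact absurd hαβ not_top_lt
  | bot =>
    exact absurd hlt (not_two_mul_iSup_absTerm_bot_lt hαβ ha hlam
      (fun σ hσ => hsum σ (EReal.bot_lt_coe σ) hσ) hL)
  | coe α =>
    by_contra! hcon
    obtain ⟨b, hb1, hb2⟩ := EReal.lt_iff_exists_real_btwn.1 hαβ
    have hαb : α < b := by exact_mod_cast hb1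
    set M := ⨆ i, absTerm a lam α i with hM
    have hMtop : M ≠ ⊤ := by
      intro h
      rw [h, ENNReal.mul_top two_ne_zero] at hlt
      exact not_top_lt hlt
    have hrM : ∀ i, ‖a i‖ * Real.exp (lam i * α) ≤ M.toReal := fun i => by
      have h := le_iSup (absTerm a lam α) i
      rw [absTerm_coe] at h
      exact (ENNReal.ofReal_le_iff_le_toReal hMtop).1 h
    have hsb := hsum b hb1 hb2
    -- The dominant index may vary with t, so all terms at b are bounded by one constant.
    set S := ∑' i, ‖a i‖ * Real.exp (lam i * b) with hS
    have hrS : ∀ i, ‖a i‖ * Real.exp (lam i * b) ≤ S := fun i =>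
      hsb.le_tsum i fun j _ => by positivity
    have hpath : Tendsto (fun t : ℝ => ((α + t * (b - α) : ℝ) : EReal)) (𝓝[>] 0) (𝓝[>] (α : EReal)) := by
      refine tendsto_nhdsWithin_iff.2 ⟨?_, ?_⟩
      · have : Continuous fun t : ℝ => ((α + t * (b - α) : ℝ) : EReal) :=
          continuous_coe_real_ereal.comp (by fun_prop)
        have := (this.tendsto 0).mono_left (nhdsWithin_le_nhds (s := Ioi 0))
        simpa using this
      · filter_upwards [self_mem_nhdsWithin] with t ht
        have : 0 < t * (b - α) := mul_pos ht (by linarith)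
        exact EReal.coe_lt_coe_iff.2 (by linarith)
    have hlim : Tendsto (fun t : ℝ => ENNReal.ofReal (2 * ((1 - t) * M.toReal + t * S))) (𝓝[>] 0)
        (𝓝 (2 * M)) := by
      have : Continuous fun t : ℝ => ENNReal.ofReal (2 * ((1 - t) * M.toReal + t * S)) :=
        ENNReal.continuous_ofReal.comp (by fun_prop)
      have := (this.tendsto 0).mono_left (nhdsWithin_le_nhds (s := Ioi 0))
      have e : ENNReal.ofReal (2 * ((1 - 0) * M.toReal + 0 * S)) = 2 * M := by
        rw [sub_zero, one_mul, zero_mul, add_zero, ENNReal.ofReal_mul two_pos.le,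
          ENNReal.ofReal_toReal hMtop]
        simp
      rwa [e] at this
    refine absurd (le_of_tendsto_of_tendsto (hL.comp hpath) hlim ?_) (not_le.2 hlt)
    have hIoo : Ioo (0 : ℝ) 1 ∈ 𝓝[>] (0 : ℝ) := Ioo_mem_nhdsGT one_pos
    filter_upwards [hIoo] with t ht
    set σ := α + t * (b - α) with hσ
    have hσ1 : α < σ := by nlinarith [ht.1]
    have hσ2 : σ < b := by nlinarith [ht.2]
    have hσ1' : (α : EReal) < σ := EReal.coe_lt_coe_iff.2 hσ1
    have hσ2' : (σ : EReal) < β := (EReal.coe_lt_coe_iff.2 hσ2).trans hb2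
    obtain ⟨i, hi⟩ := hcon σ hσ1' hσ2'
    simp only [Function.comp, absTerm_coe]
    rw [← ENNReal.ofReal_tsum_of_nonneg (fun i => by positivity) (hsum σ hσ1' hσ2')]
    refine ENNReal.ofReal_le_ofReal (hi.le.trans ?_)
    have hconv := convexOn_exp.2 (mem_univ (lam i * α)) (mem_univ (lam i * b))
      (show 0 ≤ 1 - t by linarith [ht.2]) ht.1.le (by ring)
    simp only [smul_eq_mul] at hconv
    rw [show (1 - t) * (lam i * α) + t * (lam i * b) = lam i * σ by rw [hσ]; ring] at hconv
    have k1 := mul_le_mul_of_nonneg_left hconv (norm_nonneg (a i))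
    have k2 := mul_le_mul_of_nonneg_left (hrM i) (show 0 ≤ 1 - t by linarith [ht.2])
    have k3 := mul_le_mul_of_nonneg_left (hrS i) ht.1.le
    nlinarith

/-- The reflection σ ↦ -σ, λ ↦ -λ preserves every term and exchanges the two endpoints. -/
theorem exists_no_dominant_term_right {ι : Type*} {α β : EReal} (hαβ : α < β) {a : ι → ℂ}
    {lam : ι → ℝ} (ha : ∀ i, a i ≠ 0) (hlam : ∀ i, lam i ≠ 0)
    (hsum : ∀ σ : ℝ, α < σ → (σ : EReal) < β → Summable fun i => ‖a i‖ * Real.exp (lam i * σ))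
    {L : ENNReal}
    (hL : Tendsto (fun σ : EReal => ∑' i, absTerm a lam σ i) (𝓝[<] β) (𝓝 L))
    (hlt : 2 * (⨆ i, absTerm a lam β i) < L) :
    ∃ σ : ℝ, α < σ ∧ (σ : EReal) < β ∧
      ∀ i, 2 * (‖a i‖ * Real.exp (lam i * σ)) ≤ ∑' j, ‖a j‖ * Real.exp (lam j * σ) := by
  have hneg : Tendsto (fun σ : EReal => -σ) (𝓝[>] (-β)) (𝓝[<] β) := by
    refine tendsto_nhdsWithin_iff.2 ⟨?_, ?_⟩
    · have := ((continuous_neg (G := EReal)).tendsto (-β)).mono_left (nhdsWithin_le_nhds (s := Ioi (-β)))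
      rwa [neg_neg] at this
    · filter_upwards [self_mem_nhdsWithin] with σ hσ
      exact EReal.neg_lt_of_neg_lt hσ
  have hterm : ∀ σ i, absTerm a lam (-σ) i = absTerm a (fun i => -lam i) σ i := fun σ i => by
    rw [← absTerm_neg, neg_neg]
  obtain ⟨σ, h1, h2, h3⟩ := exists_no_dominant_term_left (α := -β) (β := -α)
    (lam := fun i => -lam i) (EReal.neg_lt_neg_iff.2 hαβ) ha (fun i => neg_ne_zero.2 (hlam i))
    (fun σ hσ1 hσ2 => by
      have := hsum (-σ) (by rw [EReal.coe_neg]; exact EReal.lt_neg_of_lt_neg hσ2)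
        (by rw [EReal.coe_neg]; exact EReal.neg_lt_of_neg_lt hσ1)
      simpa only [neg_mul, mul_neg] using this)
    (L := L) ((hL.comp hneg).congr fun σ => by simp only [Function.comp, hterm])
    (by simpa only [absTerm_neg] using hlt)
  refine ⟨-σ, by rw [EReal.coe_neg]; exact EReal.lt_neg_of_lt_neg h2,
    by rw [EReal.coe_neg]; exact EReal.neg_lt_of_neg_lt h1, fun i => ?_⟩
  simpa only [neg_mul, mul_neg] using h3 i

end APStrip

theorem mainTheorem7 {ι : Type*} [Countable ι] (α β : EReal) (hαβ : α < β)
    (f : ℂ → ℂ) (a : ι → ℂ) (lam : ι → ℝ)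
    (hU : APStrip.IsLargestStrip α β f)
    (hf : APStrip.IsDirichletSeries α β f a lam)
    (hcard : 3 ≤ ENat.card ι)
    (hind : LinearIndependent ℚ lam)
    (hcond :
      (∃ L : ENNReal,
        Tendsto (fun σ : EReal => ∑' i, APStrip.absTerm a lam σ i) (𝓝[>] α) (𝓝 L) ∧
          2 * (⨆ i, APStrip.absTerm a lam α i) < L) ∨
      (∃ L : ENNReal,
        Tendsto (fun σ : EReal => ∑' i, APStrip.absTerm a lam σ i) (𝓝[<] β) (𝓝 L) ∧
          2 * (⨆ i, APStrip.absTerm a lam β i) < L)) :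
    (APStrip.zeroProj α β f).Nonempty := by
  have hap := hU.1
  have hsum : ∀ σ : ℝ, α < σ → (σ : EReal) < β →
      Summable fun i => ‖a i‖ * Real.exp (lam i * σ) := fun σ h1 h2 => hf.summable hap hind h1 h2
  have hlam : ∀ i, lam i ≠ 0 := fun i => hind.ne_zero i
  obtain ⟨σ, h1, h2, hσ⟩ : ∃ σ : ℝ, α < σ ∧ (σ : EReal) < β ∧
      ∀ i, 2 * (‖a i‖ * Real.exp (lam i * σ)) ≤ ∑' j, ‖a j‖ * Real.exp (lam j * σ) := by
    rcases hcond with ⟨L, hL, hlt⟩ | ⟨L, hL, hlt⟩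
    · exact APStrip.exists_no_dominant_term_left hαβ hf.ne_zero hlam hsum hL hlt
    · exact APStrip.exists_no_dominant_term_right hαβ hf.ne_zero hlam hsum hL hlt
  have : Nonempty ι := by
    by_contra hne
    rw [not_nonempty_iff] at hne
    rw [(ENat.card_eq_zero_iff_empty ι).2 hne] at hcard
    norm_num at hcard
  obtain ⟨θ, hθ⟩ := APStrip.exists_phases_tsum_eq_zero (fun i => by positivity) (hsum σ h1 h2) hσ
  -- Subtracting arg a_i makes the rotated coefficient equal to |a_i| e^{iθ_i}, so the rotated
  -- series at σ is the closed polygon.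
  obtain ⟨s, hs, hs0⟩ := APStrip.exists_zero_of_rotated_zero hap.1 hf.ne_zero hind hsum
    (fun s hs => hf.eq_tsum hap hind hs) (fun i => θ i - (a i).arg) h1 h2 (by
      rw [← hθ]
      refine tsum_congr fun i => ?_
      conv_lhs => rw [← Complex.norm_mul_exp_arg_mul_I (a i)]
      rw [mul_assoc (‖a i‖ : ℂ), ← Complex.exp_add]
      push_cast
      rw [mul_right_comm]
      congr 3
      simp
      ring)
  exact ⟨s.re, subset_closure ⟨s, ⟨hs, hs0⟩, rfl⟩, hs⟩
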